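/- Let $V$ be a three-dimensional complex vector space with a hermitian form $\langle-,-\rangle$ of signature $++-$, linear in the first argument, let $\mathbb B=\{p\in\mathbb PV\mid\langle p,p\rangle<0\}$ be the complex hyperbolic plane, and let $\mathrm{PU}$ be the projective unitary group of $V$. For $p\in\mathbb B$, write a tangent vector at $p$ as $v_p=\langle-,p\rangle v\in\mathrm{Hom}_{\mathbb C}(\mathbb Cp,V/\mathbb Cp)$ with $v\in p^\perp$, and put $\langle v_p,w_p\rangle=-\langle p,p\rangle\langle v,w\rangle$ and $\omega(v_p,w_p)=\mathrm{Im}\,\langle v_p,w_p\rangle$. For a positive $m\in V$ let $R(m)x=2\frac{\langle x,m\rangle}{\langle m,m\rangle}m-x$ be the reflection in the complex geodesic $\mathbb Pm^\perp$. Let $n\ge5$, and let $S_1,\dots,S_n$ (indices modulo $n$) be complex geodesics such that $S_i$ and $S_{i+1}$ are ultraparallel for all $i$. Let $R_i=R(m_i)$ be the reflection in the middle slice of the segment of bisector $\mathrm B[S_i,S_{i+1}]$, i.e. in its slice such that the reflection in it exchanges $S_i$ and $S_{i+1}$. Suppose that these segments form a cycle of bisectors: $R_n\cdots R_1=\delta$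 for some $\delta\in\mathbb C$ (then $\delta^3=1$). Let $\varrho:H_n\to\mathrm{PU}$, $r_i\mapsto R_i$, be the induced representation of $$H_n=\langle r_1,\dots,r_n\mid r_n\cdots r_1=1,\ r_i^2=1\rangle .$$ Let $P$ be a simply connected geodesic $n$-gon in the real hyperbolic plane $\mathbb H^2_{\mathbb R}$ with counterclockwise listed vertices $v_1,\dots,v_n$ and interior angles of sum $2\pi$, and let $r_i$ act on $\mathbb H^2_{\mathbb R}$ as the reflection in the middle point of the edge from $v_i$ to $v_{i+1}$, so that $P$ is a fundamental polygon for $H_n$. The Toledo invariant of $\varrho$ is $\tau=\frac4{2\pi}\int_P\varphi^*\omega$, where $\varphi:\mathbb H^2_{\mathbb R}\to\mathbb B$ is a smooth $\varrho$-equivariant map. The Toledo invariant of the restriction of $\varrho$ to a subgroup of finite index is defined in the same way, with a map that is equivariant under the subgroup and a fundamental region of the subgroup consisting of copies of $P$ (the integrals over the copies are added). (1) The Toledo invariant of $\varrho$ satisfies $\tau\equiv n-\dfrac{\mathrm{Arg}\,\delta}{\pi}\mod 2$. (2) If $n$ is even, the Toledo invariant of the restriction of $\varrho$ to $G_n=\langle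 r_1r_i\mid 2\le i\le n\rangle$, with the fundamental region $P\cup r_1P$, satisfies $\tau\equiv-\dfrac{2\,\mathrm{Arg}\,\delta}{\pi}\mod 4$. (3) If $n$ is odd, the Toledo invariant of the restriction of $\varrho$ to the subgroup $T_n$ generated by $r_2r_1r_n$, $r_2r_nr_1$, $r_2r_1r_2r_1$, $r_1r_i$ and $r_2r_1r_ir_2$ for $3\le i\le n-1$, with the fundamental region $P\cup r_1P\cup r_2P\cup r_2r_1P$, satisfies $\tau\equiv4n-\dfrac{4\,\mathrm{Arg}\,\delta}{\pi}\mod 8$. Here $a\equiv b\mod c$ for real $a,b$ means $a-b\in c\,\mathbb Z$. -/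

import Mathlib

open scoped ContDiff ComplexConjugate

noncomputable section

namespace CxHyp

/-! ## The complex hyperbolic plane -/

/-- The three-dimensional complex space carrying the hermitian form of signature `++-`. -/
abbrev V : Type := Fin 3 → ℂ

/-- The hermitian form of signature `++-`, linear in the first argument. -/
def herm (x y : V) : ℂ := x 0 * conj (y 0) + x 1 * conj (y 1) - x 2 * conj (y 2)

/-- A vector representing a point of `ℙ V` outside the closed ball. -/
def IsPositive (p : V) : Prop := 0 < (herm p p).re

/-- A vector representing a point of the complex hyperbolic plane
`𝔹 = {p ∈ ℙ V | ⟨p, p⟩ < 0}`. -/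
def IsNegative (p : V) : Prop := (herm p p).re < 0

/-- The tance of two nonisotropic points (this is always a real number). -/
def tance (p q : V) : ℝ := (herm p q * herm q p / (herm p p * herm q q)).re

theorem herm_add_left (x y z : V) : herm (x + y) z = herm x z + herm y z := by
  simp only [herm, Pi.add_apply]; ring

theorem herm_smul_left (a : ℂ) (x z : V) : herm (a • x) z = a * herm x z := by
  simp only [herm, Pi.smul_apply, smul_eq_mul]; ring

theorem herm_sub_left (x y z : V) : herm (x - y) z = herm x z - herm y z := by
  simp only [herm, Pi.sub_apply]; ring

theorem herm_conj (x y : V) : conj (herm x y) = herm y x := by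
  simp only [herm, map_add, map_sub, map_mul, Complex.conj_conj]; ring

theorem herm_smul_right (a : ℂ) (x z : V) : herm x (a • z) = conj a * herm x z := by
  rw [← herm_conj, herm_smul_left, map_mul, herm_conj]

theorem herm_sub_right (x y z : V) : herm x (y - z) = herm x y - herm x z := by
  rw [← herm_conj, herm_sub_left, map_sub, herm_conj, herm_conj]

/-- The unitary group `U` of the hermitian form. -/
def U : Subgroup (V ≃ₗ[ℂ] V) where
  carrier := {g | ∀ x y, herm (g x) (g y) = herm x y}
  one_mem' := fun _ _ => rfl
  mul_mem' := fun {a b} ha hb x y => by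
    show herm (a (b x)) (a (b y)) = herm x y
    rw [ha, hb]
  inv_mem' := fun {a} ha x y => by
    have h := ha (a.symm x) (a.symm y)
    rw [a.apply_symm_apply, a.apply_symm_apply] at h
    exact h.symm

/-- The projective unitary group `PU`. -/
abbrev PU : Type := U ⧸ Subgroup.center U

/-- The linear map `x ↦ 2 (⟨x, p⟩ / ⟨p, p⟩) p - x`. -/
def reflLin (p : V) : V →ₗ[ℂ] V where
  toFun x := (2 * (herm x p / herm p p)) • p - x
  map_add' x y := by
    rw [herm_add_left, add_div, mul_add, add_smul]; abel
  map_smul' a x := by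
    rw [herm_smul_left, RingHom.id_apply, smul_sub, smul_smul]
    congr 2; ring

theorem reflLin_apply (p x : V) : reflLin p x = (2 * (herm x p / herm p p)) • p - x := rfl

theorem reflLin_involutive (p : V) : Function.Involutive (reflLin p) := by
  intro x
  by_cases h : herm p p = 0
  · simp [reflLin_apply, h]
  · have h1 : herm (reflLin p x) p = herm x p := by
      rw [reflLin_apply, herm_sub_left, herm_smul_left]
      field_simp; ring
    rw [reflLin_apply p (reflLin p x), h1, reflLin_apply]
    abel

theorem reflLin_herm (p x y : V) : herm (reflLin p x) (reflLin p y) = herm x y := by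
  by_cases h : herm p p = 0
  · have hn : ∀ z, reflLin p z = -z := fun z => by simp [reflLin_apply, h]
    simp only [hn, herm, Pi.neg_apply, map_neg]
    ring
  · have hc : conj (herm p p) = herm p p := herm_conj p p
    simp only [reflLin_apply, herm_sub_left, herm_sub_right, herm_smul_left, herm_smul_right,
      map_mul, map_div₀, hc, herm_conj, map_ofNat]
    field_simp; ring

/-- The reflection `R(p)` as an element of the unitary group. For positive `p` it is the
reflection in the complex geodesic with polar point `p`. -/
def refl (p : V) : U :=
  ⟨LinearEquiv.ofInvolutive (reflLin p) (reflLin_involutive p), reflLin_herm p⟩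

theorem refl_mul_self (p : V) : refl p * refl p = 1 :=
  Subtype.ext (LinearEquiv.ext (reflLin_involutive p))

/-! ## Complex geodesics, segments of bisectors and their cycles -/

/-- The complex geodesic with polar point `p` (for positive `p`), closed in the closed ball,
in homogeneous coordinates: the set of all nonzero vectors that represent its points. -/
def complexGeodesic (p : V) : Set V :=
  {x | x ≠ 0 ∧ (herm x x).re ≤ 0 ∧ herm x p = 0}

/-- `q` is the polar point of a slice of the segment of bisector `B[S, S']`, where `p` and `p'`
are the polar points of the ultraparallel complex geodesics `S` and `S'`. The vectors `p` and
`⟨p, p'⟩ p'` have a positive hermitian product, so their real span is the real plane whose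
projectivization is the real spine, and the polar points of the slices from `S` to `S'` are
their combinations with nonnegative real coefficients. The segment of bisector is the union of
these slices. -/
def IsSlicePolar (p p' q : V) : Prop :=
  ∃ (a b : ℝ) (c : ℂ), 0 ≤ a ∧ 0 ≤ b ∧ (a ≠ 0 ∨ b ≠ 0) ∧ c ≠ 0 ∧
    q = c • ((a : ℂ) • p + ((b : ℂ) * herm p p') • p')

/-- `m` is the polar point of the middle slice of `B[S, S']`: the slice such that the reflection
in it exchanges `S` and `S'`. -/
def IsMiddleSlice (p p' m : V) : Prop :=
  IsPositive m ∧ IsSlicePolar p p' m ∧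
    (reflLin m) '' complexGeodesic p = complexGeodesic p' ∧
    (reflLin m) '' complexGeodesic p' = complexGeodesic p

/-- The product `f n * f (n - 1) * ⋯ * f 2 * f 1`; the indices are modulo `n`. -/
def cyclicProd {G : Type*} [Monoid G] (n : ℕ) (f : ZMod n → G) : G :=
  ((List.range n).map fun k => f ((k : ZMod n) + 1)).reverse.prod

/-- A cycle of bisectors `B_i = B[S_i, S_{i+1}]`, `i` modulo `n`: the complex geodesics `S_i`
have polar points `p i`, consecutive ones are ultraparallel, the middle slice of `B_i` has polar
point `m i`, and the reflections `R_i` in the middle slices satisfy `R_n ⋯ R_1 = δ`.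
(Taking determinants, one sees that `δ ^ 3 = 1`.) -/
structure BisectorCycle (n : ℕ) where
  p : ZMod n → V
  m : ZMod n → V
  δ : ℂ
  pos : ∀ i, IsPositive (p i)
  ultraparallel : ∀ i, 1 < tance (p i) (p (i + 1))
  middle : ∀ i, IsMiddleSlice (p i) (p (i + 1)) (m i)
  rel : ∀ x : V, (cyclicProd n (fun i => refl (m i)) : U).1 x = δ • x

/-- The relators `r_n ⋯ r_1` and `r_i ^ 2`. -/
def relators (n : ℕ) : Set (FreeGroup (ZMod n)) :=
  {cyclicProd n FreeGroup.of} ∪ Set.range fun i => FreeGroup.of i ^ 2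

/-- The group `H_n = ⟨r_1, …, r_n | r_n ⋯ r_1 = 1, r_i ^ 2 = 1⟩`. -/
abbrev H (n : ℕ) : Type := PresentedGroup (relators n)

/-- The generator `r_i` of `H_n`. -/
def r {n : ℕ} (i : ZMod n) : H n := PresentedGroup.of i

theorem map_cyclicProd {G K : Type*} [Monoid G] [Monoid K] (φ : G →* K) (n : ℕ)
    (f : ZMod n → G) : φ (cyclicProd n f) = cyclicProd n (fun i => φ (f i)) := by
  simp [cyclicProd, map_list_prod, List.map_reverse, List.map_map, Function.comp_def]

/-- The class in `PU` of the reflection `R_i` in the middle slice of `B_i`. -/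
def BisectorCycle.R {n : ℕ} (C : BisectorCycle n) (i : ZMod n) : PU :=
  QuotientGroup.mk (refl (C.m i))

theorem BisectorCycle.relators_map {n : ℕ} (C : BisectorCycle n) :
    ∀ w ∈ relators n, FreeGroup.lift C.R w = 1 := by
  rintro w (rfl | ⟨i, rfl⟩)
  · rw [map_cyclicProd]
    simp only [FreeGroup.lift_apply_of]
    have h := map_cyclicProd (QuotientGroup.mk' (Subgroup.center U)) n (fun i => refl (C.m i))
    refine h.symm.trans ((QuotientGroup.eq_one_iff _).2 (Subgroup.mem_center_iff.2 fun g => ?_))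
    refine Subtype.ext (LinearEquiv.ext fun x => ?_)
    show g.1 ((cyclicProd n (fun i => refl (C.m i)) : U).1 x) =
      (cyclicProd n (fun i => refl (C.m i)) : U).1 (g.1 x)
    rw [C.rel, C.rel, map_smul]
  · show FreeGroup.lift C.R (FreeGroup.of i ^ 2) = 1
    rw [map_pow, FreeGroup.lift_apply_of, pow_two]
    show ((refl (C.m i) * refl (C.m i) : U) : PU) = 1
    rw [refl_mul_self]; rfl

/-- The representation `H_n → PU` given by `r_i ↦ R_i`. -/
def BisectorCycle.rep {n : ℕ} (C : BisectorCycle n) : H n →* PU :=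
  PresentedGroup.toGroup C.relators_map

/-! ## The hyperbolic plane and the action of `H_n` on it

The hyperbolic plane is the open unit disc of `ℂ` in the Klein model: geodesics are straight
chords and the orientation is the usual one. -/

/-- The underlying set of the hyperbolic plane. -/
def disc : Set ℂ := Metric.ball 0 1

/-- The hyperbolic metric of the Klein disc at `x`. -/
def kleinInner (x u w : ℂ) : ℝ :=
  (u * conj w).re / (1 - ‖x‖ ^ 2) +
    (x * conj u).re * (x * conj w).re / (1 - ‖x‖ ^ 2) ^ 2

/-- The hyperbolic area form of the Klein disc at `x`. -/
def kleinArea (x u w : ℂ) : ℝ :=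
  (conj u * w).im / ((1 - ‖x‖ ^ 2) * Real.sqrt (1 - ‖x‖ ^ 2))

/-- The oriented hyperbolic angle in `(0, 2π]` from the direction `u` to the direction `w` at
the point `x`, measured counterclockwise. -/
def orientedAngle (x u w : ℂ) : ℝ :=
  let θ := Complex.arg ⟨kleinInner x u w, kleinArea x u w⟩
  if 0 < θ then θ else θ + 2 * Real.pi

/-- The hyperbolic midpoint of two points of the Klein disc: the point represented by the sum of
the normalized vectors `(a, 1) / √(1 - |a|²)` and `(b, 1) / √(1 - |b|²)` of the hyperboloid. -/
def midpt (a b : ℂ) : ℂ :=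
  ((Real.sqrt (1 - ‖b‖ ^ 2) : ℂ) * a + (Real.sqrt (1 - ‖a‖ ^ 2) : ℂ) * b) /
    ((Real.sqrt (1 - ‖b‖ ^ 2) : ℂ) + (Real.sqrt (1 - ‖a‖ ^ 2) : ℂ))

/-- The real Lorentz form on the vectors `(x, 1)` and `(y, 1)`. -/
def lor (x y : ℂ) : ℝ := (x * conj y).re - 1

/-- The reflection in the point `m` of the Klein disc (the rotation by `π` about `m`): in
homogeneous coordinates it is `X ↦ 2 (⟨X, M⟩ / ⟨M, M⟩) M - X`. -/
def halfTurn (m x : ℂ) : ℂ :=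
  (2 * ((lor x m / lor m m : ℝ) : ℂ) * m - x) / (2 * ((lor x m / lor m m : ℝ) : ℂ) - 1)

/-- The winding number about `x` of the closed polygonal line with vertices `v 1, …, v n`
(for `x` outside the line). -/
def winding {n : ℕ} (v : ZMod n → ℂ) (x : ℂ) : ℝ :=
  (∑ k ∈ Finset.range n,
    Complex.arg ((v ((k : ZMod n) + 1) - x) / (v (k : ZMod n) - x))) / (2 * Real.pi)

/-- A simply connected geodesic `n`-gon in the hyperbolic plane (not necessarily convex) whose
interior angles add up to `2π`, with the vertices listed counterclockwise. The interior angle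
at `v i` is measured from the edge towards `v (i + 1)` to the edge towards `v (i - 1)`. -/
structure GeodesicPolygon (n : ℕ) where
  v : ZMod n → ℂ
  mem_disc : ∀ i, v i ∈ disc
  injective : Function.Injective v
  simple : ∀ i j, i ≠ j →
    segment ℝ (v i) (v (i + 1)) ∩ segment ℝ (v j) (v (j + 1)) ⊆
      {v i, v (i + 1)} ∩ {v j, v (j + 1)}
  ccw : ∀ x, (∀ i, x ∉ segment ℝ (v i) (v (i + 1))) → winding v x = 0 ∨ winding v x = 1
  angle_sum : ∑ k ∈ Finset.range n,
    orientedAngle (v (k : ZMod n)) (v ((k : ZMod n) + 1) - v (k : ZMod n))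
      (v ((k : ZMod n) - 1) - v (k : ZMod n)) = 2 * Real.pi

/-- The polygon as a closed region: the edges and the points they wind around. -/
def GeodesicPolygon.region {n : ℕ} (P : GeodesicPolygon n) : Set ℂ :=
  {x | (∃ i, x ∈ segment ℝ (P.v i) (P.v (i + 1))) ∨ winding P.v x = 1}

/-- The reflection `r_i` in the middle point of the edge from `v i` to `v (i + 1)`. -/
def GeodesicPolygon.turn {n : ℕ} (P : GeodesicPolygon n) (i : ZMod n) (x : ℂ) : ℂ :=
  halfTurn (midpt (P.v i) (P.v (i + 1))) x

/-- The action on the hyperbolic plane of the word `r_{i₁} r_{i₂} ⋯ r_{iₖ}`. -/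
def GeodesicPolygon.act {n : ℕ} (P : GeodesicPolygon n) (w : List (ZMod n)) (x : ℂ) : ℂ :=
  w.foldr P.turn x

/-- The element `r_{i₁} r_{i₂} ⋯ r_{iₖ}` of `H_n`. Since the generators are involutions, every
element of `H_n` is of this form. -/
def word {n : ℕ} (w : List (ZMod n)) : H n := (w.map r).prod

/-! ## The Toledo invariant -/

/-- The component in `p^⊥` of a vector `a`, for nonisotropic `p`. -/
def proj (p a : V) : V := a - (herm a p / herm p p) • p

/-- The hermitian metric on the tangent space of `𝔹` at `p`. A vector `a` stands for the tangent
vector of `ℙ V` at `p` given by the linear map `p ↦ a` modulo `p`. That tangent vector is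
`v_p = ⟨-, p⟩ v` with `v = proj p a / ⟨p, p⟩ ∈ p^⊥`, and `⟨v_p, w_p⟩ = -⟨p, p⟩ ⟨v, w⟩`. -/
def tangentHerm (p a b : V) : ℂ :=
  -herm p p * herm ((herm p p)⁻¹ • proj p a) ((herm p p)⁻¹ • proj p b)

/-- The Kähler form `ω = Im ⟨-, -⟩`. -/
def kaehler (p a b : V) : ℝ := (tangentHerm p a b).im

/-- The coefficient, with respect to the standard area form of the disc, of the pull-back of `ω`
under the map to `𝔹` that is represented by `F`. -/
def pullbackKaehler (F : ℂ → V) (x : ℂ) : ℝ :=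
  kaehler (F x) (fderiv ℝ F x 1) (fderiv ℝ F x Complex.I)

/-- `F` represents a smooth map from the hyperbolic plane to `𝔹`, `x ↦ [F x]`, which is
equivariant under the subgroup `Γ` of `H_n` with respect to `ρ`, where `r_i` acts on the
hyperbolic plane as the reflection in the middle of the `i`-th edge of `P`. (Every smooth map to
`𝔹` has a smooth lift to `V`, because `𝔹` is contained in an affine chart of `ℙ V`.) -/
structure IsEquivariantMap {n : ℕ} (Γ : Subgroup (H n)) (ρ : H n →* PU)
    (P : GeodesicPolygon n) (F : ℂ → V) : Prop where
  smooth : ContDiffOn ℝ ∞ F disc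
  negative : ∀ x ∈ disc, IsNegative (F x)
  equivariant : ∀ w : List (ZMod n), word w ∈ Γ → ∀ g : U, (g : PU) = ρ (word w) →
    ∀ x ∈ disc, ∃ c : ℂ, F (P.act w x) = c • g.1 (F x)

/-- `τ` is the Toledo invariant of the restriction to `Γ` of the representation `ρ` of `H_n`:
the integral of `4 / (2π)` times the pull-back of the Kähler form under a `Γ`-equivariant map,
over the fundamental region of `Γ` that consists of the copies `w P`, `w ∈ W`, of the fundamental
polygon `P` of `H_n`. -/
def IsToledoInvariant {n : ℕ} (Γ : Subgroup (H n)) (W : List (List (ZMod n)))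
    (ρ : H n →* PU) (τ : ℝ) : Prop :=
  ∃ (P : GeodesicPolygon n) (F : ℂ → V), IsEquivariantMap Γ ρ P F ∧
    τ = 4 / (2 * Real.pi) *
      (W.map fun w => ∫ x in P.act w '' P.region, pullbackKaehler F x).sum

/-- The subgroup `G_n = ⟨r_1 r_i | 2 ≤ i ≤ n⟩` of `H_n` (for even `n`). -/
def G (n : ℕ) : Subgroup (H n) :=
  Subgroup.closure {h | ∃ i : ℕ, 2 ≤ i ∧ i ≤ n ∧ h = r 1 * r (i : ZMod n)}

/-- The subgroup `T_n` of `H_n` (for odd `n`) generated by `x = r_2 r_1 r_n`, `y = r_2 r_n r_1`,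
`z = r_2 r_1 r_2 r_1`, `x_i = r_1 r_i` and `y_i = r_2 r_1 r_i r_2`, where `3 ≤ i ≤ n - 1`. -/
def T (n : ℕ) : Subgroup (H n) :=
  Subgroup.closure
    ({r 2 * r 1 * r (n : ZMod n), r 2 * r (n : ZMod n) * r 1, r 2 * r 1 * r 2 * r 1} ∪
      {h | ∃ i : ℕ, 3 ≤ i ∧ i + 1 ≤ n ∧
        (h = r 1 * r (i : ZMod n) ∨ h = r 2 * r 1 * r (i : ZMod n) * r 2)})

/-- The fundamental region `P` of `H_n`. -/
def regionH (n : ℕ) : List (List (ZMod n)) := [[]]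

/-- The fundamental region `P ∪ r_1 P` of `G_n`. -/
def regionG (n : ℕ) : List (List (ZMod n)) := [[], [1]]

/-- The fundamental region `P ∪ r_1 P ∪ r_2 P ∪ r_2 r_1 P` of `T_n`. -/
def regionT (n : ℕ) : List (List (ZMod n)) := [[], [1], [2], [2, 1]]

end CxHyp

end

/-!
For a lift `F` of a map to `𝔹`, the real one-form `θ = Im ⟨dF, F⟩ / ⟨F, F⟩` satisfies
`dθ = 2 φ^* ω` (`curl_liftForm`). By Green's theorem for the polygon
(`GeodesicPolygon.integral_curl`), `π τ` is therefore the sum of the integrals of `θ` along the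
boundary of `P`, over the lifts `Φ u = g_u⁻¹ F(u ·)` attached to the representatives `u` of the
cosets of the subgroup. Here Green's theorem is proved by writing the winding number of the boundary
as a sum of winding numbers of triangles with a vertex at `0`.

Subtracting from `θ` the differential of the argument of `⟨F, y⟩` gives the Kähler potential with
base point `y`, which does not depend on the lift. On the edge from `v i` to `v (i + 1)` let
`y = y i` be a negative vector orthogonal to `m i`, so that `R_i (y i) = -y i`. The half-turn `r_i`
reverses the edge, and it permutes the maps `Φ u` up to `R_i` and factors. Hence the potentials with base point
`y i` cancel in the sum over `u`, and only the variation of the argument of `⟨Φ u, y i⟩` along the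
edge remains (`sum_edgeIntegral`). A continuous argument is available because
`⟨p, a⟩ ⟨a, b⟩ ⟨b, p⟩` has negative real part for negative vectors (`cartan_re_pos`).

The points `Φ u (v (i + 1))` are, up to order, the points `R_i Φ u (v i)`. So `π τ` is the sum over
`u` of `E (Φ u (v 1))`, where `E p` is a sum over the orbit `p, R_1 p, R_2 R_1 p, …`
(`BisectorCycle.totalArg`). Each reflection changes the sign of `⟨-, y i⟩`, so that, modulo `2π`,
the sum telescopes to `E p = n π - Arg δ`. Being continuous on the connected space `𝔹`, the
function `E` is constant (`exists_totalArg_eq`): `π τ` is the index times one and the same real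
number congruent to `n π - Arg δ` modulo `2π`. This yields the moduli `2`, `4` and `8` for the
indices `1`, `2` and `4`.
-/

noncomputable section

namespace CxHyp

open MeasureTheory Set Filter Topology

/-! ### Green's theorem for geodesic polygons of the Klein disc -/

/-- The cross product, or determinant, of two vectors of the plane. -/
def cross (z w : ℂ) : ℝ := z.re * w.im - z.im * w.re

theorem isOpen_disc : IsOpen disc := Metric.isOpen_ball

theorem convex_disc : Convex ℝ disc := convex_ball 0 1

theorem zero_mem_disc : (0 : ℂ) ∈ disc := Metric.mem_ball_self one_pos

theorem antisymm_eq_cross_mul (B : ℂ →L[ℝ] ℂ →L[ℝ] ℝ) (z w : ℂ) :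
    B z w - B w z = cross z w * (B 1 Complex.I - B Complex.I 1) := by
  have h : ∀ u : ℂ, u = u.re • (1 : ℂ) + u.im • Complex.I := fun u => by
    simp [Complex.re_add_im]
  have hB : ∀ z w : ℂ, B z w = z.re * w.re * B 1 1 + z.re * w.im * B 1 Complex.I
      + z.im * w.re * B Complex.I 1 + z.im * w.im * B Complex.I Complex.I := fun z w => by
    conv_lhs => rw [h z, h w]
    simp only [map_add, map_smul, _root_.add_apply, _root_.smul_apply,
      smul_eq_mul]
    ring
  rw [hB z w, hB w z, cross]; ring

theorem det_eq_cross (L : ℂ →L[ℝ] ℂ) : L.det = cross (L 1) (L Complex.I) := by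
  rw [ContinuousLinearMap.det, ← LinearMap.det_toMatrix Complex.basisOneI, Matrix.det_fin_two]
  simp [LinearMap.toMatrix_apply, cross]; ring

/-- The coefficient of the exterior derivative of a one-form of the plane. -/
def curl (η : ℂ → ℂ →L[ℝ] ℝ) (x : ℂ) : ℝ :=
  fderiv ℝ η x 1 Complex.I - fderiv ℝ η x Complex.I 1

/-- The integral of a one-form along the straight segment from `a` to `b`. -/
def edgeIntegral (η : ℂ → ℂ →L[ℝ] ℝ) (a b : ℂ) : ℝ :=
  ∫ t in (0 : ℝ)..1, η (a + t • (b - a)) (b - a)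

theorem segmentPoint_mem {a b : ℂ} (ha : a ∈ disc) (hb : b ∈ disc) {t : ℝ} (ht : t ∈ Icc (0 : ℝ) 1) :
    a + t • (b - a) ∈ disc :=
  convex_disc.add_smul_sub_mem ha hb ht

/-- The parametrization of the triangle with vertices `0`, `a`, `b` by the unit square. -/
def coneMap (a b : ℂ) (s t : ℝ) : ℂ := s • (a + t • (b - a))

theorem coneMap_mem {a b : ℂ} (ha : a ∈ disc) (hb : b ∈ disc) {s t : ℝ} (hs : s ∈ Icc (0 : ℝ) 1)
    (ht : t ∈ Icc (0 : ℝ) 1) : coneMap a b s t ∈ disc :=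
  convex_disc.smul_mem_of_zero_mem zero_mem_disc (segmentPoint_mem ha hb ht) hs

theorem continuousOn_curl {η : ℂ → ℂ →L[ℝ] ℝ} (hη : ContDiffOn ℝ 1 η disc) :
    ContinuousOn (curl η) disc := by
  have h := hη.continuousOn_fderiv_of_isOpen isOpen_disc le_rfl
  unfold curl
  fun_prop

theorem continuous_coneMap (a b : ℂ) : Continuous fun p : ℝ × ℝ => coneMap a b p.1 p.2 := by
  unfold coneMap; fun_prop

/-- Green's theorem for the triangle with vertices `0`, `a`, `b`, degenerate or not, pulled back to
the unit square by `coneMap`. The integrals along the two sides at `0` depend on one vertex each, so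
that they cancel when such identities are added along a closed polygon. -/
theorem integral_cone {η : ℂ → ℂ →L[ℝ] ℝ} (hη : ContDiffOn ℝ 1 η disc) {a b : ℂ} (ha : a ∈ disc)
    (hb : b ∈ disc) :
    ∫ s in (0 : ℝ)..1, ∫ t in (0 : ℝ)..1, s * cross a b * curl η (coneMap a b s t) =
      edgeIntegral η a b - edgeIntegral η 0 b + edgeIntegral η 0 a := by
  have hcont := hη.continuousOn
  have hd : ∀ x ∈ disc, HasFDerivAt η (fderiv ℝ η x) x := fun x hx =>
    ((hη.differentiableOn one_ne_zero).differentiableAt (isOpen_disc.mem_nhds hx)).hasFDerivAt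
  set Φ : ℝ × ℝ → ℂ := fun p => coneMap a b p.1 p.2 with hΦ
  have hΦc : Continuous Φ := continuous_coneMap a b
  have hmaps : MapsTo Φ (uIcc 0 1 ×ˢ uIcc 0 1) disc := by
    rintro ⟨s, t⟩ ⟨hs, ht⟩
    rw [uIcc_of_le zero_le_one] at hs ht
    exact coneMap_mem ha hb hs ht
  let γ' : ℝ × ℝ →L[ℝ] ℂ := (ContinuousLinearMap.snd ℝ ℝ ℝ).smulRight (b - a)
  have hγ : ∀ p : ℝ × ℝ, HasFDerivAt (fun p : ℝ × ℝ => a + p.2 • (b - a)) γ' p := fun p =>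
    (((ContinuousLinearMap.snd ℝ ℝ ℝ).hasFDerivAt (x := p)).smul_const (b - a)).const_add a
  let Φ' : ℝ × ℝ → ℝ × ℝ →L[ℝ] ℂ := fun p =>
    p.1 • γ' + (ContinuousLinearMap.fst ℝ ℝ ℝ).smulRight (a + p.2 • (b - a))
  have hΦ' : ∀ p, HasFDerivAt Φ (Φ' p) p := fun p =>
    ((ContinuousLinearMap.fst ℝ ℝ ℝ).hasFDerivAt (x := p)).smul (hγ p)
  -- `f` and `-g` are the components of the pulled-back form along `∂/∂t` and `∂/∂s`; the second
  -- derivatives of `Φ` cancel in the divergence.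
  let f : ℝ × ℝ → ℝ := fun p => η (Φ p) (p.1 • (b - a))
  let g : ℝ × ℝ → ℝ := fun p => -η (Φ p) (a + p.2 • (b - a))
  have hηΦ : ContinuousOn (fun p => η (Φ p)) (uIcc 0 1 ×ˢ uIcc 0 1) :=
    hcont.comp hΦc.continuousOn hmaps
  have hfst : ∀ p : ℝ × ℝ, HasFDerivAt (fun p : ℝ × ℝ => p.1 • (b - a))
      ((ContinuousLinearMap.fst ℝ ℝ ℝ).smulRight (b - a)) p := fun p =>
    ((ContinuousLinearMap.fst ℝ ℝ ℝ).hasFDerivAt (x := p)).smul_const (b - a)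
  have hin : ∀ p ∈ Ioo (min (0 : ℝ) 1) (max 0 1) ×ˢ Ioo (min (0 : ℝ) 1) (max 0 1),
      Φ p ∈ disc := by
    rintro p hp
    refine hmaps ⟨?_, ?_⟩
    · exact Ioo_subset_Icc_self hp.1
    · exact Ioo_subset_Icc_self hp.2
  have key : ∀ p : ℝ × ℝ, p.1 * cross a b * curl η (Φ p) =
      fderiv ℝ η (Φ p) (a + p.2 • (b - a)) (p.1 • (b - a)) -
        fderiv ℝ η (Φ p) (p.1 • (b - a)) (a + p.2 • (b - a)) := fun p => by
    rw [antisymm_eq_cross_mul, curl]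
    congr 1
    simp [cross]; ring
  have main := integral2_divergence_prod_of_hasFDerivAt f g
    (fun p => (η (Φ p)).comp ((ContinuousLinearMap.fst ℝ ℝ ℝ).smulRight (b - a)) +
      ((fderiv ℝ η (Φ p)).comp (Φ' p)).flip (p.1 • (b - a)))
    (fun p => -((η (Φ p)).comp γ' +
      ((fderiv ℝ η (Φ p)).comp (Φ' p)).flip (a + p.2 • (b - a)))) 0 0 1 1
    (hηΦ.clm_apply (by fun_prop)) (hηΦ.clm_apply (by fun_prop)).neg
    (fun p hp => ((hd _ (hin p hp)).comp p (hΦ' p)).clm_apply (hfst p))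
    (fun p hp => (((hd _ (hin p hp)).comp p (hΦ' p)).clm_apply (hγ p)).neg)
  have hval : ∀ p : ℝ × ℝ, ((η (Φ p)).comp ((ContinuousLinearMap.fst ℝ ℝ ℝ).smulRight (b - a)) +
      ((fderiv ℝ η (Φ p)).comp (Φ' p)).flip (p.1 • (b - a))) (1, 0) +
      (-((η (Φ p)).comp γ' +
      ((fderiv ℝ η (Φ p)).comp (Φ' p)).flip (a + p.2 • (b - a)))) (0, 1) =
      p.1 * cross a b * curl η (Φ p) := fun p => by
    rw [key]
    simp only [Φ', γ']
    generalize a + p.2 • (b - a) = e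
    generalize b - a = d
    simp [-Complex.real_smul]
    ring
  simp only [hval] at main
  rw [main]
  · have h1 : ∀ v : ℂ, edgeIntegral η 0 v = ∫ s in (0 : ℝ)..1, η (s • v) v := fun v => by
      simp [edgeIntegral]
    have h2 : ∫ x in (0 : ℝ)..1, g (x, 1) = -∫ s in (0 : ℝ)..1, η (s • b) b := by
      rw [← intervalIntegral.integral_neg]
      simp only [g, Φ, coneMap, one_smul, add_sub_cancel]
    have h3 : ∫ x in (0 : ℝ)..1, g (x, 0) = -∫ s in (0 : ℝ)..1, η (s • a) a := by
      rw [← intervalIntegral.integral_neg]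
      simp only [g, Φ, coneMap, zero_smul, add_zero]
    rw [h1, h1, h2, h3]
    simp only [f, Φ, coneMap, edgeIntegral, one_smul, zero_smul, map_zero,
      intervalIntegral.integral_zero]
    ring
  · refine ContinuousOn.integrableOn_compact (isCompact_uIcc.prod isCompact_uIcc) ?_
    have := (continuousOn_curl hη).comp hΦc.continuousOn hmaps
    exact (by fun_prop : ContinuousOn (fun p : ℝ × ℝ => p.1 * cross a b) _).mul this

/-- The open triangle with vertices `0`, `a`, `b`, in barycentric coordinates; it is empty when
the vertices are collinear. -/
def triangle (a b : ℂ) : Set ℂ :=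
  {x | 0 < cross a b * cross a x ∧ 0 < cross a b * cross x b ∧
    0 < cross a b * (cross a b - cross a x - cross x b)}

theorem measurableSet_triangle (a b : ℂ) : MeasurableSet (triangle a b) := by
  have : IsOpen (triangle a b) := by
    unfold triangle cross
    simp only [ofPred_and]
    refine (isOpen_lt (by fun_prop) (by fun_prop)).inter
      ((isOpen_lt (by fun_prop) (by fun_prop)).inter (isOpen_lt (by fun_prop) (by fun_prop)))
  exact this.measurableSet

/-- Cramer's rule. -/
theorem cross_cramer (a b x : ℂ) : cross a b • x = cross x b • a + cross a x • b := by
  apply Complex.ext <;> simp [cross] <;> ring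

theorem image_coneMap {a b : ℂ} (h : cross a b ≠ 0) :
    (fun z : ℂ => coneMap a b z.re z.im) '' (Ioo 0 1 ×ℂ Ioo 0 1) = triangle a b := by
  have hpos : 0 < cross a b ^ 2 := by positivity
  ext x
  simp only [mem_image, Complex.mem_reProdIm, mem_Ioo, triangle, mem_ofPred_eq]
  constructor
  · rintro ⟨z, ⟨⟨hs0, hs1⟩, ht0, ht1⟩, rfl⟩
    have e1 : cross a (coneMap a b z.re z.im) = z.re * z.im * cross a b := by
      simp [cross, coneMap]; ring
    have e2 : cross (coneMap a b z.re z.im) b = z.re * (1 - z.im) * cross a b := by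
      simp [cross, coneMap]; ring
    rw [e1, e2]
    have h1 : 0 < 1 - z.im := by linarith
    have h2 : 0 < 1 - z.re := by linarith
    refine ⟨?_, ?_, ?_⟩
    · have : 0 < z.re * z.im * cross a b ^ 2 := by positivity
      linarith
    · have : 0 < z.re * (1 - z.im) * cross a b ^ 2 := by positivity
      linarith
    · have : 0 < (1 - z.re) * cross a b ^ 2 := by positivity
      linarith
  · rintro ⟨h1, h2, h3⟩
    set D := cross a b with hD
    have p1 : 0 < cross a x / D := by
      have : cross a x / D = D * cross a x / D ^ 2 := by field_simp
      rw [this]; positivity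
    have p2 : 0 < cross x b / D := by
      have : cross x b / D = D * cross x b / D ^ 2 := by field_simp
      rw [this]; positivity
    have p3 : 0 < 1 - cross a x / D - cross x b / D := by
      have : 1 - cross a x / D - cross x b / D = D * (D - cross a x - cross x b) / D ^ 2 := by
        field_simp
      rw [this]; positivity
    set α := cross a x / D
    set β := cross x b / D
    refine ⟨⟨α + β, α / (α + β)⟩, ⟨⟨by positivity, by show α + β < 1; linarith⟩, by positivity, ?_⟩, ?_⟩
    · show α / (α + β) < 1
      rw [div_lt_one (by positivity)]; linarith
    · have hx : x = β • a + α • b := by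
        have := cross_cramer a b x
        have h' : x = D⁻¹ • (cross x b • a + cross a x • b) := by
          rw [← this, smul_smul, inv_mul_cancel₀ h, one_smul]
        rw [h', smul_add, smul_smul, smul_smul]
        simp only [α, β, div_eq_inv_mul]
      rw [hx]
      have hne : α + β ≠ 0 := by positivity
      show (α + β) • (a + (α / (α + β)) • (b - a)) = _
      rw [smul_add, smul_smul, mul_div_cancel₀ _ hne, smul_sub, add_smul]
      abel

theorem coneMap_mem_disc {a b : ℂ} (ha : a ∈ disc) (hb : b ∈ disc) {z : ℂ}
    (hz : z ∈ Icc 0 1 ×ℂ Icc 0 1) : coneMap a b z.re z.im ∈ disc :=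
  coneMap_mem ha hb hz.1 hz.2

theorem integrableOn_triangle {h : ℂ → ℝ} (hh : ContinuousOn h disc) {a b : ℂ} (ha : a ∈ disc)
    (hb : b ∈ disc) : IntegrableOn h (triangle a b) := by
  by_cases hD : cross a b = 0
  · have : triangle a b = ∅ := by ext x; simp [triangle, hD]
    simp [this]
  · have hc : Continuous fun z : ℂ => coneMap a b z.re z.im := by unfold coneMap; fun_prop
    have hK : IsCompact ((fun z : ℂ => coneMap a b z.re z.im) '' (Icc 0 1 ×ℂ Icc 0 1)) :=
      (isCompact_Icc.reProdIm isCompact_Icc).image hc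
    refine ((hh.mono ?_).integrableOn_compact hK).mono_set ?_
    · rintro _ ⟨z, hz, rfl⟩
      exact coneMap_mem_disc ha hb hz
    · rw [← image_coneMap hD]
      exact image_mono (inter_subset_inter (preimage_mono Ioo_subset_Icc_self)
        (preimage_mono Ioo_subset_Icc_self))

theorem injOn_coneMap {a b : ℂ} (h : cross a b ≠ 0) :
    InjOn (fun z : ℂ => coneMap a b z.re z.im) (Ioo 0 1 ×ℂ Ioo 0 1) := by
  intro z hz w hw hzw
  have e1 : ∀ z : ℂ, cross a (coneMap a b z.re z.im) = z.re * z.im * cross a b := fun z => by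
    simp [cross, coneMap]; ring
  have e2 : ∀ z : ℂ, cross (coneMap a b z.re z.im) b = z.re * (1 - z.im) * cross a b := fun z => by
    simp [cross, coneMap]; ring
  simp only at hzw
  have h1 := mul_right_cancel₀ h ((e1 z).symm.trans ((congrArg _ hzw).trans (e1 w)))
  have h2 := mul_right_cancel₀ h
    ((e2 z).symm.trans ((congrArg (fun y => cross y b) hzw).trans (e2 w)))
  have hr : z.re = w.re := by linarith
  rw [hr] at h1
  exact Complex.ext hr (mul_left_cancel₀ hw.1.1.ne' h1)

/-- The orientation of the triangle enters through the sign of `cross a b`. -/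
theorem integral_triangle {h : ℂ → ℝ} (hh : ContinuousOn h disc) {a b : ℂ} (ha : a ∈ disc)
    (hb : b ∈ disc) :
    ∫ s in (0 : ℝ)..1, ∫ t in (0 : ℝ)..1, s * cross a b * h (coneMap a b s t) =
      SignType.sign (cross a b) * ∫ x in triangle a b, h x := by
  by_cases hD : cross a b = 0
  · simp [hD]
  have hder : ∀ z : ℂ, HasFDerivAt (fun z : ℂ => coneMap a b z.re z.im)
      (z.re • Complex.imCLM.smulRight (b - a) +
        Complex.reCLM.smulRight (a + z.im • (b - a))) z := fun z =>
    (Complex.reCLM.hasFDerivAt (x := z)).smul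
      (((Complex.imCLM.hasFDerivAt (x := z)).smul_const (b - a)).const_add a)
  have hdet : ∀ z : ℂ, (z.re • Complex.imCLM.smulRight (b - a) +
        Complex.reCLM.smulRight (a + z.im • (b - a))).det = z.re * cross a b := fun z => by
    rw [det_eq_cross]
    simp [cross]; ring
  have hmeas : MeasurableSet (Ioo (0 : ℝ) 1 ×ℂ Ioo (0 : ℝ) 1) :=
    (isOpen_Ioo.reProdIm isOpen_Ioo).measurableSet
  rw [← image_coneMap hD, integral_image_eq_integral_abs_det_fderiv_smul volume hmeas
    (fun z _ => (hder z).hasFDerivWithinAt) (injOn_coneMap hD)]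
  have e : ∫ z in (Ioo (0 : ℝ) 1 ×ℂ Ioo (0 : ℝ) 1), |(z.re • Complex.imCLM.smulRight (b - a) +
        Complex.reCLM.smulRight (a + z.im • (b - a))).det| • h (coneMap a b z.re z.im) =
      ∫ z in (Ioo (0 : ℝ) 1 ×ℂ Ioo (0 : ℝ) 1),
        z.re * |cross a b| * h (coneMap a b z.re z.im) := by
    refine setIntegral_congr_fun hmeas fun z hz => ?_
    simp only [hdet, abs_mul, abs_of_pos hz.1.1, smul_eq_mul]
  rw [e]
  have e2 : ∫ z in (Ioo (0 : ℝ) 1 ×ℂ Ioo (0 : ℝ) 1),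
        z.re * |cross a b| * h (coneMap a b z.re z.im) =
      ∫ p in Ioo (0 : ℝ) 1 ×ˢ Ioo (0 : ℝ) 1, p.1 * |cross a b| * h (coneMap a b p.1 p.2) := by
    have := Complex.volume_preserving_equiv_real_prod.setIntegral_preimage_emb
      Complex.measurableEquivRealProd.measurableEmbedding
      (fun p : ℝ × ℝ => p.1 * |cross a b| * h (coneMap a b p.1 p.2)) (Ioo (0 : ℝ) 1 ×ˢ Ioo (0 : ℝ) 1)
    exact this
  have hcont : ContinuousOn (fun p : ℝ × ℝ => p.1 * |cross a b| * h (coneMap a b p.1 p.2))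
      (Icc (0 : ℝ) 1 ×ˢ Icc (0 : ℝ) 1) := by
    have : ContinuousOn (fun p : ℝ × ℝ => h (coneMap a b p.1 p.2)) (Icc (0 : ℝ) 1 ×ˢ Icc (0 : ℝ) 1) :=
      hh.comp (continuous_coneMap a b).continuousOn fun p hp => coneMap_mem ha hb hp.1 hp.2
    exact (by fun_prop : ContinuousOn (fun p : ℝ × ℝ => p.1 * |cross a b|) _).mul this
  rw [e2, Measure.volume_eq_prod, setIntegral_prod]
  · simp only [← integral_Ioc_eq_integral_Ioo, ← intervalIntegral.integral_of_le zero_le_one]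
    rw [← intervalIntegral.integral_const_mul]
    congr 1; ext s
    rw [← intervalIntegral.integral_const_mul]
    congr 1; ext t
    have : cross a b = SignType.sign (cross a b) * |cross a b| := (sign_mul_abs _).symm
    conv_lhs => rw [this]
    ring
  · exact (hcont.integrableOn_compact (isCompact_Icc.prod isCompact_Icc)).mono_set
      (prod_mono Ioo_subset_Icc_self Ioo_subset_Icc_self)

/-! ### Winding numbers of closed polygons -/

theorem im_div_eq_cross (w z : ℂ) : (w / z).im = cross z w / Complex.normSq z := by
  rw [Complex.div_im, cross]; ring

/-- The angles under which the three sides of a triangle are seen add up to `± 2π` when they have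
the same sign, and to `0` otherwise. -/
theorem arg_add_arg_add_arg {z₁ z₂ z₃ : ℂ} (h : z₁ * z₂ * z₃ = 1) (h₁ : z₁.im ≠ 0)
    (h₂ : z₂.im ≠ 0) (h₃ : z₃.im ≠ 0) :
    z₁.arg + z₂.arg + z₃.arg =
      if 0 < z₁.im ∧ 0 < z₂.im ∧ 0 < z₃.im then 2 * Real.pi
      else if z₁.im < 0 ∧ z₂.im < 0 ∧ z₃.im < 0 then -(2 * Real.pi) else 0 := by
  have hz : ∀ {z : ℂ}, z.im ≠ 0 → z ≠ 0 := by rintro _ h rfl; simp at h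
  have hk : ((z₁.arg + z₂.arg + z₃.arg : ℝ) : Real.Angle) = (0 : ℝ) := by
    rw [Real.Angle.coe_add, Real.Angle.coe_add, ← Complex.arg_mul_coe_angle (hz h₁) (hz h₂),
      ← Complex.arg_mul_coe_angle (mul_ne_zero (hz h₁) (hz h₂)) (hz h₃), h, Complex.arg_one]
  obtain ⟨k, hk⟩ := Real.Angle.angle_eq_iff_two_pi_dvd_sub.1 hk
  rw [sub_zero] at hk
  have hπ := Real.pi_pos
  have bd : ∀ z : ℂ, z.im ≠ 0 → (0 < z.im ∧ 0 < z.arg ∧ z.arg < Real.pi) ∨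
      (z.im < 0 ∧ z.arg < 0 ∧ -Real.pi < z.arg) := fun z h => by
    rcases lt_or_gt_of_ne h with h' | h'
    · exact Or.inr ⟨h', Complex.arg_neg_iff.2 h', Complex.neg_pi_lt_arg z⟩
    · refine Or.inl ⟨h', lt_of_le_of_ne (Complex.arg_nonneg_iff.2 h'.le) fun h0 => ?_,
        Complex.arg_lt_pi_iff.2 (Or.inr h)⟩
      exact h (Complex.arg_eq_zero_iff.1 h0.symm).2
  have lo : ∀ j : ℤ, 2 * Real.pi * j < 2 * Real.pi * k → j < k := fun j hj => by
    exact_mod_cast lt_of_mul_lt_mul_left hj (by positivity)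
  have hi : ∀ j : ℤ, 2 * Real.pi * k < 2 * Real.pi * j → k < j := fun j hj => by
    exact_mod_cast lt_of_mul_lt_mul_left hj (by positivity)
  rw [hk]
  rcases bd z₁ h₁ with ⟨p₁, a₁, b₁⟩ | ⟨p₁, a₁, b₁⟩ <;>
  rcases bd z₂ h₂ with ⟨p₂, a₂, b₂⟩ | ⟨p₂, a₂, b₂⟩ <;>
  rcases bd z₃ h₃ with ⟨p₃, a₃, b₃⟩ | ⟨p₃, a₃, b₃⟩
  · have l := lo 0 (by push_cast; linarith)
    have u := hi 2 (by push_cast; linarith)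
    obtain rfl : k = 1 := by omega
    simp [p₁, p₂, p₃]
  pick_goal 7
  · have l := lo (-2) (by push_cast; linarith)
    have u := hi 0 (by push_cast; linarith)
    obtain rfl : k = -1 := by omega
    simp [p₁, p₂, p₃, p₁.not_gt]
  all_goals
    have l := lo (-1) (by push_cast; linarith)
    have u := hi 1 (by push_cast; linarith)
    obtain rfl : k = 0 := by omega
    simp [p₁.not_gt, p₂.not_gt, p₃.not_gt]

/-- The winding number of the boundary of the triangle with vertices `0`, `a`, `b` about a point
off the lines through two of the vertices. -/
def triangleWinding (a b x : ℂ) : ℝ :=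
  SignType.sign (cross a b) * (triangle a b).indicator 1 x

/-- The angle under which the side `a b` of the triangle `0 a b` is seen: once the winding number of
the triangle is split off, what remains cancels along a closed polygon. -/
theorem arg_triangle {a b x : ℂ} (h₁ : cross a x ≠ 0) (h₂ : cross x b ≠ 0)
    (h₃ : cross a b - cross a x - cross x b ≠ 0) :
    Complex.arg ((b - x) / (a - x)) = 2 * Real.pi * triangleWinding a b x +
      Complex.arg ((b - x) / (-x)) - Complex.arg ((a - x) / (-x)) := by
  have e₁ : cross (-x) (a - x) = cross a x := by simp [cross]; ring
  have e₂ : cross (a - x) (b - x) = cross a b - cross a x - cross x b := by simp [cross]; ring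
  have e₃ : cross (b - x) (-x) = cross x b := by simp [cross]; ring
  have hx : -x ≠ 0 := by rintro h; rw [neg_eq_zero] at h; simp [h, cross] at h₁
  have ha : a - x ≠ 0 := by
    intro h; rw [sub_eq_zero] at h; subst h; exact h₁ (by simp [cross]; ring)
  have hb : b - x ≠ 0 := by
    intro h; rw [sub_eq_zero] at h; subst h; exact h₂ (by simp [cross]; ring)
  have nx := Complex.normSq_pos.2 hx
  have na := Complex.normSq_pos.2 ha
  have nb := Complex.normSq_pos.2 hb
  have i₁ : ((a - x) / (-x)).im = cross a x / Complex.normSq (-x) := by rw [im_div_eq_cross, e₁]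
  have i₂ : ((b - x) / (a - x)).im =
      (cross a b - cross a x - cross x b) / Complex.normSq (a - x) := by rw [im_div_eq_cross, e₂]
  have i₃ : ((-x) / (b - x)).im = cross x b / Complex.normSq (b - x) := by
    rw [im_div_eq_cross, e₃]
  have key := arg_add_arg_add_arg (z₁ := (a - x) / (-x)) (z₂ := (b - x) / (a - x))
    (z₃ := (-x) / (b - x)) (by
      generalize -x = w at *; field_simp) (by rw [i₁]; exact div_ne_zero h₁ nx.ne')
    (by rw [i₂]; exact div_ne_zero h₃ na.ne') (by rw [i₃]; exact div_ne_zero h₂ nb.ne')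
  have hinv : Complex.arg ((-x) / (b - x)) = -Complex.arg ((b - x) / (-x)) := by
    rw [← inv_div (b - x) (-x), Complex.arg_inv, if_neg]
    rw [Complex.arg_eq_pi_iff, im_div_eq_cross]
    rintro ⟨-, h⟩
    have e₄ : cross (-x) (b - x) = -cross x b := by simp [cross]; ring
    rw [e₄] at h
    exact div_ne_zero (neg_ne_zero.2 h₂) nx.ne' h
  rw [hinv] at key
  have : (if 0 < ((a - x) / (-x)).im ∧ 0 < ((b - x) / (a - x)).im ∧ 0 < ((-x) / (b - x)).im then
      2 * Real.pi
      else if ((a - x) / (-x)).im < 0 ∧ ((b - x) / (a - x)).im < 0 ∧ ((-x) / (b - x)).im < 0 then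
      -(2 * Real.pi) else 0) = 2 * Real.pi * triangleWinding a b x := by
    rw [i₁, i₂, i₃]
    simp only [div_pos_iff_of_pos_right, div_neg_iff, nx, na, nb, nx.not_gt, na.not_gt, nb.not_gt,
      and_true, and_false, false_or]
    rw [triangleWinding]
    split_ifs with hp hn
    · have hD : 0 < cross a b := by linarith
      have hm : x ∈ triangle a b := ⟨mul_pos hD hp.1, mul_pos hD hp.2.2, mul_pos hD hp.2.1⟩
      rw [sign_pos hD, indicator_of_mem hm]; simp
    · have hD : cross a b < 0 := by linarith
      have hm : x ∈ triangle a b := ⟨mul_pos_of_neg_of_neg hD hn.1,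
        mul_pos_of_neg_of_neg hD hn.2.2, mul_pos_of_neg_of_neg hD hn.2.1⟩
      rw [sign_neg hD, indicator_of_mem hm]; simp
    · rw [indicator_of_notMem]
      · simp
      rintro ⟨m₁, m₂, m₃⟩
      rcases lt_trichotomy (cross a b) 0 with hD | hD | hD
      · have hneg : ∀ {y : ℝ}, 0 < cross a b * y → y < 0 := fun h => by
          by_contra h'
          exact h.not_ge (mul_nonpos_of_nonpos_of_nonneg hD.le (not_lt.1 h'))
        exact hn ⟨hneg m₁, hneg m₃, hneg m₂⟩
      · simp [hD] at m₁
      · exact hp ⟨pos_of_mul_pos_right m₁ hD.le, pos_of_mul_pos_right m₃ hD.le,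
          pos_of_mul_pos_right m₂ hD.le⟩
  rw [this] at key
  linarith

/-- A straight line has measure zero. -/
theorem volume_line {c : ℂ} (hc : c ≠ 0) (d : ℂ) : volume {x : ℂ | cross c (x - d) = 0} = 0 := by
  let L : ℂ →ₗ[ℝ] ℝ := c.re • Complex.imCLM.toLinearMap - c.im • Complex.reCLM.toLinearMap
  have hL : ∀ x, L x = cross c x := fun x => by simp [L, cross]
  have h0 : volume (LinearMap.ker L : Set ℂ) = 0 := by
    refine Measure.addHaar_submodule _ _ fun h => hc ?_
    have h1 : cross c (Complex.I * c) = 0 := by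
      rw [← hL]; exact LinearMap.mem_ker.1 (h ▸ Submodule.mem_top)
    have h2 : cross c (Complex.I * c) = Complex.normSq c := by
      simp [cross, Complex.normSq_apply]
    rw [h2] at h1
    exact Complex.normSq_eq_zero.1 h1
  have : {x : ℂ | cross c (x - d) = 0} = (fun x => x - d) ⁻¹' (LinearMap.ker L : Set ℂ) := by
    ext x; simp [hL]
  rw [this]
  simp only [sub_eq_add_neg]
  rw [measure_preimage_add_right, h0]

theorem ae_cross_ne_zero {c : ℂ} (hc : c ≠ 0) (d : ℂ) :
    ∀ᵐ x : ℂ, cross c (x - d) ≠ 0 := by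
  simpa [ae_iff] using volume_line hc d

/-- The formula of `arg_triangle` also holds for `a = 0` or `b = 0`, where the triangle is degenerate
and one of the conditions of `arg_triangle` always fails. -/
theorem ae_arg_triangle {a b : ℂ} (hab : a ≠ b) :
    ∀ᵐ x : ℂ, Complex.arg ((b - x) / (a - x)) = 2 * Real.pi * triangleWinding a b x +
      Complex.arg ((b - x) / (-x)) - Complex.arg ((a - x) / (-x)) := by
  have h0 : ∀ᵐ x : ℂ, x ≠ 0 := by simp [ae_iff]
  rcases eq_or_ne a 0 with rfl | ha
  · filter_upwards [h0] with x hx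
    have : (0 : ℝ) = cross 0 b := by simp [cross]
    simp [triangleWinding, ← this, hx]
  rcases eq_or_ne b 0 with rfl | hb
  · filter_upwards [h0, ae_cross_ne_zero ha 0] with x hx hx'
    have : (0 : ℝ) = cross a 0 := by simp [cross]
    simp only [triangleWinding, ← this, zero_sub, sign_zero, SignType.coe_zero, zero_mul, mul_zero,
      zero_add, ne_eq, neg_eq_zero, hx, not_false_eq_true, div_self, Complex.arg_one]
    rw [← inv_div (a - x) (-x), Complex.arg_inv, if_neg]
    rw [Complex.arg_eq_pi_iff, im_div_eq_cross]
    rintro ⟨-, h⟩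
    have e : cross (-x) (a - x) = cross a (x - 0) := by simp [cross]; ring
    rw [e] at h
    exact div_ne_zero hx' (Complex.normSq_pos.2 (neg_ne_zero.2 hx)).ne' h
  filter_upwards [ae_cross_ne_zero ha 0, ae_cross_ne_zero hb 0,
    ae_cross_ne_zero (sub_ne_zero.2 hab.symm) a] with x h₁ h₂ h₃
  refine arg_triangle ?_ ?_ ?_
  · simpa using h₁
  · rw [sub_zero] at h₂
    have : cross x b = -cross b x := by simp [cross]; ring
    rw [this]; exact neg_ne_zero.2 h₂
  · have : cross a b - cross a x - cross x b = cross (b - a) (x - a) := by simp [cross]; ring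
    rw [this]; exact h₃

theorem ae_notMem_segment {a b : ℂ} (hab : a ≠ b) : ∀ᵐ x : ℂ, x ∉ segment ℝ a b := by
  filter_upwards [ae_cross_ne_zero (sub_ne_zero.2 hab.symm) a] with x hx
  rw [segment_eq_image']
  rintro ⟨t, -, rfl⟩
  exact hx (by simp [cross]; ring)

/-- Complex numbers of positive real part have an additive argument. -/
theorem arg_div_of_re_pos {z w : ℂ} (hz : 0 < z.re) (hw : 0 < w.re) :
    Complex.arg (z / w) = z.arg - w.arg := by
  have hz' : z ≠ 0 := by rintro rfl; simp at hz
  have hw' : w ≠ 0 := by rintro rfl; simp at hw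
  have h1 := abs_lt.1 (Complex.abs_arg_lt_pi_div_two_iff.2 (Or.inl hz))
  have h2 := abs_lt.1 (Complex.abs_arg_lt_pi_div_two_iff.2 (Or.inl hw))
  rw [← Complex.arg_coe_angle_toReal_eq_arg, Complex.arg_div_coe_angle hz' hw',
    ← Real.Angle.coe_sub, Real.Angle.toReal_coe_eq_self_iff]
  constructor <;> linarith

variable {n : ℕ}

theorem natCast_add_one (k : ℕ) : (k : ZMod n) + 1 = ((k + 1 : ℕ) : ZMod n) := by push_cast; rfl

theorem sum_cyclic_sub (f : ZMod n → ℝ) :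
    ∑ k ∈ Finset.range n, (f ((k : ZMod n) + 1) - f k) = 0 := by
  simp only [natCast_add_one]
  rw [Finset.sum_range_sub fun k : ℕ => f k]
  simp

/-- A closed polygonal line in the disc does not wind around the points outside the disc. -/
theorem winding_eq_zero {v : ZMod n → ℂ} (hv : ∀ i, v i ∈ disc) {x : ℂ} (hx : x ∉ disc) :
    winding v x = 0 := by
  have hx1 : 1 ≤ ‖x‖ := by simpa [disc] using hx
  have hpos : ∀ i, 0 < ((v i - x) * (-conj x)).re := fun i => by
    have h1 : ‖v i‖ < 1 := by simpa [disc] using hv i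
    have h2 : (v i * conj x).re ≤ ‖v i‖ * ‖x‖ := by
      refine (Complex.re_le_norm _).trans ?_
      rw [norm_mul, Complex.norm_conj]
    have h3 : ((v i - x) * (-conj x)).re = ‖x‖ ^ 2 - (v i * conj x).re := by
      rw [← Complex.normSq_eq_norm_sq, Complex.normSq_apply]
      simp; ring
    rw [h3]
    nlinarith
  -- Multiplied by `-conj x`, the vectors from `x` to the vertices lie in the right half plane.
  have hx0 : -conj x ≠ 0 := by
    rw [neg_ne_zero, map_ne_zero]
    rintro rfl; simp at hx1; linarith
  have : ∀ k : ZMod n, Complex.arg ((v (k + 1) - x) / (v k - x)) =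
      Complex.arg ((v (k + 1) - x) * (-conj x)) - Complex.arg ((v k - x) * (-conj x)) := fun k => by
    rw [← arg_div_of_re_pos (hpos _) (hpos _), mul_div_mul_right _ _ hx0]
  rw [winding, Finset.sum_congr rfl fun (k : ℕ) _ => this k,
    sum_cyclic_sub fun i => Complex.arg ((v i - x) * (-conj x)), zero_div]

namespace GeodesicPolygon

variable (P : GeodesicPolygon n)

theorem region_subset_disc : P.region ⊆ disc := by
  rintro x (⟨i, hi⟩ | hx)
  · exact convex_disc.segment_subset (P.mem_disc _) (P.mem_disc _) hi
  · by_contra h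
    rw [winding_eq_zero P.mem_disc h] at hx
    exact zero_ne_one hx

theorem measurableSet_region [NeZero n] : MeasurableSet P.region := by
  have h1 : MeasurableSet {x | ∃ i, x ∈ segment ℝ (P.v i) (P.v (i + 1))} := by
    have : {x | ∃ i, x ∈ segment ℝ (P.v i) (P.v (i + 1))} =
        ⋃ i, segment ℝ (P.v i) (P.v (i + 1)) := by ext; simp
    rw [this]
    refine MeasurableSet.iUnion fun i => ?_
    have : IsCompact (segment ℝ (P.v i) (P.v (i + 1))) := by
      rw [segment_eq_image']
      exact isCompact_Icc.image (by fun_prop)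
    exact this.measurableSet
  have h2 : Measurable (winding P.v) := by
    unfold winding
    refine (Finset.measurable_sum _ fun k _ => ?_).div_const _
    exact Complex.measurable_arg.comp
      ((measurable_const.sub measurable_id).div (measurable_const.sub measurable_id))
  exact h1.union (h2 (measurableSet_singleton 1))

theorem vertex_ne (hn : 2 ≤ n) (i : ZMod n) : P.v i ≠ P.v (i + 1) := by
  have : Fact (1 < n) := ⟨hn⟩
  exact fun h => by simpa using P.injective h

/-- Up to a null set, the polygon is the signed sum of the triangles over its edges with apex `0`. -/
theorem ae_indicator_region (hn : 2 ≤ n) : ∀ᵐ x : ℂ, P.region.indicator (1 : ℂ → ℝ) x =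
    ∑ k ∈ Finset.range n, triangleWinding (P.v k) (P.v ((k : ZMod n) + 1)) x := by
  have : NeZero n := ⟨by omega⟩
  have h1 : ∀ᵐ x : ℂ, ∀ i : ZMod n, x ∉ segment ℝ (P.v i) (P.v (i + 1)) :=
    ae_all_iff.2 fun i => ae_notMem_segment (P.vertex_ne hn i)
  have h2 : ∀ᵐ x : ℂ, ∀ i : ZMod n, Complex.arg ((P.v (i + 1) - x) / (P.v i - x)) =
      2 * Real.pi * triangleWinding (P.v i) (P.v (i + 1)) x +
      Complex.arg ((P.v (i + 1) - x) / (-x)) - Complex.arg ((P.v i - x) / (-x)) :=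
    ae_all_iff.2 fun i => ae_arg_triangle (P.vertex_ne hn i)
  filter_upwards [h1, h2] with x hx hw
  have e : winding P.v x =
      ∑ k ∈ Finset.range n, triangleWinding (P.v k) (P.v ((k : ZMod n) + 1)) x := by
    have := sum_cyclic_sub fun i => Complex.arg ((P.v i - x) / (-x))
    rw [winding, Finset.sum_congr rfl fun (k : ℕ) _ => hw k]
    simp only [add_sub_assoc, Finset.sum_add_distrib, this, ← Finset.mul_sum, add_zero]
    exact mul_div_cancel_left₀ _ (by positivity)
  rw [← e]
  rcases P.ccw x hx with h | h
  · rw [h, indicator_of_notMem]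
    rintro (⟨i, hi⟩ | h')
    · exact hx i hi
    · rw [h] at h'; exact zero_ne_one h'
  · have hx' : x ∈ P.region := Or.inr h
    rw [h, indicator_of_mem hx']; rfl

/-- Green's theorem for a geodesic polygon. -/
theorem integral_curl (hn : 2 ≤ n) {η : ℂ → ℂ →L[ℝ] ℝ} (hη : ContDiffOn ℝ 1 η disc) :
    ∫ x in P.region, curl η x =
      ∑ k ∈ Finset.range n, edgeIntegral η (P.v k) (P.v ((k : ZMod n) + 1)) := by
  have : NeZero n := ⟨by omega⟩
  have hc := continuousOn_curl hη
  have e1 : ∫ x in P.region, curl η x = ∫ x, ∑ k ∈ Finset.range n,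
      SignType.sign (cross (P.v k) (P.v ((k : ZMod n) + 1))) *
        (triangle (P.v k) (P.v ((k : ZMod n) + 1))).indicator (curl η) x := by
    rw [← integral_indicator P.measurableSet_region]
    refine integral_congr_ae ?_
    filter_upwards [P.ae_indicator_region hn] with x hx
    have : P.region.indicator (curl η) x = P.region.indicator (1 : ℂ → ℝ) x * curl η x := by
      by_cases h : x ∈ P.region <;> simp [h]
    rw [this, hx, Finset.sum_mul]
    refine Finset.sum_congr rfl fun k _ => ?_
    rw [triangleWinding]
    by_cases h : x ∈ triangle (P.v k) (P.v ((k : ZMod n) + 1)) <;> simp [h]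
  have hint : ∀ i : ZMod n, ∫ x, SignType.sign (cross (P.v i) (P.v (i + 1))) *
        (triangle (P.v i) (P.v (i + 1))).indicator (curl η) x =
      edgeIntegral η (P.v i) (P.v (i + 1)) - (edgeIntegral η 0 (P.v (i + 1)) -
        edgeIntegral η 0 (P.v i)) := fun i => by
    rw [integral_const_mul, integral_indicator (measurableSet_triangle _ _),
      ← integral_triangle hc (P.mem_disc _) (P.mem_disc _),
      integral_cone hη (P.mem_disc _) (P.mem_disc _)]
    ring
  rw [e1, integral_finsetSum _ fun k _ => ?_, Finset.sum_congr rfl fun (k : ℕ) _ => hint k,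
    Finset.sum_sub_distrib, sum_cyclic_sub fun i => edgeIntegral η 0 (P.v i), sub_zero]
  exact ((integrableOn_triangle hc (P.mem_disc _) (P.mem_disc _)).integrable_indicator
    (measurableSet_triangle _ _)).const_mul _

end GeodesicPolygon

/-! ### Half-turns of the Klein disc -/

theorem mem_disc_iff {x : ℂ} : x ∈ disc ↔ x.re ^ 2 + x.im ^ 2 < 1 := by
  rw [disc, mem_ball_zero_iff, ← sq_lt_one_iff₀ (norm_nonneg x), Complex.sq_norm,
    Complex.normSq_apply, sq, sq]

theorem lor_eq (x y : ℂ) : lor x y = x.re * y.re + x.im * y.im - 1 := by simp [lor]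

theorem lor_self_neg {m : ℂ} (hm : m ∈ disc) : lor m m < 0 := by
  rw [mem_disc_iff] at hm; rw [lor_eq]; linarith

/-- The last homogeneous coordinate of the image of `(x, 1)` under the half-turn about `m`. -/
def turnDen (m x : ℂ) : ℝ := 2 * (lor x m / lor m m) - 1

theorem turnDen_pos {m x : ℂ} (hm : m ∈ disc) (hx : x ∈ disc) : 0 < turnDen m x := by
  have h := lor_self_neg hm
  rw [turnDen, sub_pos, ← mul_div_assoc, lt_div_iff_of_neg h, lor_eq, lor_eq]
  rw [mem_disc_iff] at hm hx
  nlinarith [sq_nonneg (x.re - m.re), sq_nonneg (x.im - m.im)]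

theorem halfTurn_re (m x : ℂ) :
    (halfTurn m x).re = (2 * (lor x m / lor m m) * m.re - x.re) / turnDen m x := by
  have : (2 * ((lor x m / lor m m : ℝ) : ℂ) - 1) = (turnDen m x : ℝ) := by
    simp [turnDen]
  rw [halfTurn, this, Complex.div_ofReal_re]
  norm_cast
  simp

theorem halfTurn_im (m x : ℂ) :
    (halfTurn m x).im = (2 * (lor x m / lor m m) * m.im - x.im) / turnDen m x := by
  have : (2 * ((lor x m / lor m m : ℝ) : ℂ) - 1) = (turnDen m x : ℝ) := by
    simp [turnDen]
  rw [halfTurn, this, Complex.div_ofReal_im]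
  norm_cast
  simp

theorem lor_halfTurn_self {m x : ℂ} (hm : m ∈ disc) (hx : x ∈ disc) :
    lor (halfTurn m x) (halfTurn m x) = lor x x / turnDen m x ^ 2 := by
  have h := (turnDen_pos hm hx).ne'
  have h2 := (lor_self_neg hm).ne
  rw [lor_eq (halfTurn m x), halfTurn_re, halfTurn_im]
  field_simp
  rw [turnDen]
  field_simp
  simp only [lor_eq]
  ring

theorem halfTurn_mem {m x : ℂ} (hm : m ∈ disc) (hx : x ∈ disc) : halfTurn m x ∈ disc := by
  have h := lor_halfTurn_self hm hx
  have h1 : lor (halfTurn m x) (halfTurn m x) < 0 := by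
    rw [h]; exact div_neg_of_neg_of_pos (lor_self_neg hx) (pow_pos (turnDen_pos hm hx) 2)
  rw [lor_eq] at h1
  rw [mem_disc_iff]; linarith

theorem lor_halfTurn {m x : ℂ} (hm : m ∈ disc) (hx : x ∈ disc) :
    lor (halfTurn m x) m = lor x m / turnDen m x := by
  have h := (turnDen_pos hm hx).ne'
  have h2 := (lor_self_neg hm).ne
  rw [lor_eq (halfTurn m x), halfTurn_re, halfTurn_im]
  field_simp
  rw [turnDen]
  field_simp
  simp only [lor_eq]
  ring

theorem turnDen_halfTurn {m x : ℂ} (hm : m ∈ disc) (hx : x ∈ disc) :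
    turnDen m (halfTurn m x) = 1 / turnDen m x := by
  have h := (turnDen_pos hm hx).ne'
  rw [turnDen, lor_halfTurn hm hx]
  field_simp
  rw [turnDen]; ring

theorem halfTurn_halfTurn {m x : ℂ} (hm : m ∈ disc) (hx : x ∈ disc) :
    halfTurn m (halfTurn m x) = x := by
  have h := (turnDen_pos hm hx).ne'
  apply Complex.ext
  · rw [halfTurn_re, turnDen_halfTurn hm hx, lor_halfTurn hm hx, halfTurn_re]
    field_simp
    ring
  · rw [halfTurn_im, turnDen_halfTurn hm hx, lor_halfTurn hm hx, halfTurn_im]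
    field_simp
    ring

theorem halfTurn_eq_smul (m x : ℂ) :
    halfTurn m x = (turnDen m x)⁻¹ • ((2 * (lor x m / lor m m)) • m - x) := by
  apply Complex.ext
  · rw [halfTurn_re]; simp; ring
  · rw [halfTurn_im]; simp; ring

theorem contDiffOn_halfTurn {m : ℂ} (hm : m ∈ disc) : ContDiffOn ℝ ∞ (halfTurn m) disc := by
  have hl : ContDiff ℝ ∞ fun x : ℂ => 2 * (lor x m / lor m m) := by
    simp only [lor_eq]
    have h1 : ContDiff ℝ ∞ Complex.re := Complex.reCLM.contDiff
    have h2 : ContDiff ℝ ∞ Complex.im := Complex.imCLM.contDiff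
    fun_prop
  have hd : ContDiffOn ℝ ∞ (fun x => (turnDen m x)⁻¹) disc :=
    (hl.sub contDiff_const).contDiffOn.inv fun x hx => (turnDen_pos hm hx).ne'
  rw [funext (halfTurn_eq_smul m)]
  exact hd.smul ((hl.smul contDiff_const).sub contDiff_id).contDiffOn

/-- A half-turn is an orientation-preserving map: its Jacobian is the inverse cube of the last
homogeneous coordinate. -/
theorem det_fderiv_halfTurn {m x : ℂ} (hm : m ∈ disc) (hx : x ∈ disc) :
    (fderiv ℝ (halfTurn m) x).det = (turnDen m x)⁻¹ ^ 3 := by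
  have hd := (turnDen_pos hm hx).ne'
  have hl := (lor_self_neg hm).ne
  let L : ℂ →L[ℝ] ℝ := m.re • Complex.reCLM + m.im • Complex.imCLM
  have h1 : HasFDerivAt (fun x => lor x m) L x := by
    have : (fun x => lor x m) = fun x => L x - 1 := by ext y; simp [lor_eq, L]; ring
    rw [this]
    exact L.hasFDerivAt.sub_const 1
  have h2 : HasFDerivAt (fun x => 2 * (lor x m / lor m m)) ((2 * (lor m m)⁻¹) • L) x := by
    have : (fun x => 2 * (lor x m / lor m m)) = fun x => (2 * (lor m m)⁻¹) • lor x m := by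
      ext y; simp; ring
    rw [this]; exact h1.const_smul (2 * (lor m m)⁻¹)
  have h3 : HasFDerivAt (fun x => (turnDen m x)⁻¹)
      ((-(turnDen m x ^ 2)⁻¹) • ((2 * (lor m m)⁻¹) • L)) x :=
    (hasDerivAt_inv hd).comp_hasFDerivAt x (h2.sub_const 1)
  have h4 := h3.smul ((h2.smul_const m).sub (hasFDerivAt_id x))
  have h5 : halfTurn m =
      (fun x => (turnDen m x)⁻¹) • ((fun x => (2 * (lor x m / lor m m)) • m) - id) :=
    funext (halfTurn_eq_smul m)
  rw [h5, h4.fderiv, det_eq_cross]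
  have ht : turnDen m x = 2 * (lor x m / lor m m) - 1 := rfl
  have hL1 : L 1 = m.re := by simp [L]
  have hLI : L Complex.I = m.im := by simp [L]
  simp only [cross, _root_.add_apply, _root_.smul_apply, _root_.sub_apply,
    ContinuousLinearMap.smulRight_apply, ContinuousLinearMap.id_apply, hL1, hLI, Pi.sub_apply,
    id, smul_eq_mul, Complex.add_re, Complex.add_im, Complex.sub_re, Complex.sub_im,
    Complex.smul_re, Complex.smul_im, Complex.one_re, Complex.one_im, Complex.I_re, Complex.I_im]
  field_simp
  rw [ht]
  field_simp
  simp only [lor_eq]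
  ring

theorem one_sub_sq_norm_pos {a : ℂ} (ha : a ∈ disc) : 0 < 1 - ‖a‖ ^ 2 := by
  rw [mem_disc_iff] at ha
  rw [Complex.sq_norm, Complex.normSq_apply]; linarith

theorem midpt_eq (a b : ℂ) : midpt a b =
    (Real.sqrt (1 - ‖b‖ ^ 2) + Real.sqrt (1 - ‖a‖ ^ 2))⁻¹ •
      (Real.sqrt (1 - ‖b‖ ^ 2) • a + Real.sqrt (1 - ‖a‖ ^ 2) • b) := by
  rw [midpt, Complex.real_smul, Complex.real_smul, Complex.real_smul]
  push_cast
  rw [div_eq_inv_mul]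

theorem midpt_comm (a b : ℂ) : midpt a b = midpt b a := by
  rw [midpt, midpt]; congr 1 <;> ring

theorem midpt_mem {a b : ℂ} (ha : a ∈ disc) (hb : b ∈ disc) : midpt a b ∈ disc := by
  have h1 := Real.sqrt_pos.2 (one_sub_sq_norm_pos ha)
  have h2 := Real.sqrt_pos.2 (one_sub_sq_norm_pos hb)
  rw [midpt_eq, smul_add, smul_smul, smul_smul]
  exact convex_disc ha hb (by positivity) (by positivity) (by field_simp)

/-- The half-turn about the midpoint exchanges the normalized vectors of the hyperboloid that represent
`a` and `b`; this is the coefficient needed to see it. -/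
theorem lor_midpt {a b : ℂ} (ha : a ∈ disc) (hb : b ∈ disc) :
    2 * (lor a (midpt a b) / lor (midpt a b) (midpt a b)) =
      (Real.sqrt (1 - ‖a‖ ^ 2) + Real.sqrt (1 - ‖b‖ ^ 2)) / Real.sqrt (1 - ‖b‖ ^ 2) := by
  have h1 := Real.sqrt_pos.2 (one_sub_sq_norm_pos ha)
  have h2 := Real.sqrt_pos.2 (one_sub_sq_norm_pos hb)
  have e1 := Real.sq_sqrt (one_sub_sq_norm_pos ha).le
  have e2 := Real.sq_sqrt (one_sub_sq_norm_pos hb).le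
  have hm := (lor_self_neg (midpt_mem ha hb)).ne
  rw [← mul_div_assoc, div_eq_div_iff hm h2.ne', midpt_eq, lor_eq, lor_eq]
  set α := Real.sqrt (1 - ‖a‖ ^ 2)
  set β := Real.sqrt (1 - ‖b‖ ^ 2)
  rw [Complex.sq_norm, Complex.normSq_apply] at e1 e2
  have f1 : a.im ^ 2 = 1 - α ^ 2 - a.re ^ 2 := by linarith
  have f2 : b.im ^ 2 = 1 - β ^ 2 - b.re ^ 2 := by linarith
  simp only [Complex.smul_re, Complex.smul_im, Complex.add_re, Complex.add_im, smul_eq_mul]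
  field_simp
  ring_nf
  rw [f1, f2]
  ring

/-- The parametrization by which the half-turn about the midpoint of the segment from `a` to `b`
acts on this segment. It is fractional linear, and not affine unless `‖a‖ = ‖b‖`, because straight
segments of the Klein disc are not parametrized proportionally to hyperbolic length. -/
def flipParam (a b : ℂ) (t : ℝ) : ℝ :=
  (1 - t) * (1 - ‖a‖ ^ 2) / ((1 - t) * (1 - ‖a‖ ^ 2) + t * (1 - ‖b‖ ^ 2))

theorem flipParam_den_pos {a b : ℂ} (ha : a ∈ disc) (hb : b ∈ disc) {t : ℝ}
    (ht : t ∈ Icc (0 : ℝ) 1) : 0 < (1 - t) * (1 - ‖a‖ ^ 2) + t * (1 - ‖b‖ ^ 2) := by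
  have h1 := one_sub_sq_norm_pos ha
  have h2 := one_sub_sq_norm_pos hb
  rcases ht.1.eq_or_lt with rfl | h
  · simpa using h1
  · have : 0 ≤ 1 - t := sub_nonneg.2 ht.2
    positivity

theorem flipParam_mem {a b : ℂ} (ha : a ∈ disc) (hb : b ∈ disc) {t : ℝ} (ht : t ∈ Icc (0 : ℝ) 1) :
    flipParam a b t ∈ Icc (0 : ℝ) 1 := by
  have h1 := one_sub_sq_norm_pos ha
  have h2 := one_sub_sq_norm_pos hb
  have h3 := flipParam_den_pos ha hb ht
  have h4 : 0 ≤ 1 - t := sub_nonneg.2 ht.2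
  have h5 := ht.1
  refine ⟨div_nonneg (by positivity) h3.le, ?_⟩
  rw [flipParam, div_le_one h3]
  have : 0 ≤ t * (1 - ‖b‖ ^ 2) := by positivity
  linarith

theorem hasDerivAt_flipParam {a b : ℂ} (ha : a ∈ disc) (hb : b ∈ disc) {t : ℝ}
    (ht : t ∈ Icc (0 : ℝ) 1) : HasDerivAt (flipParam a b)
      (-((1 - ‖a‖ ^ 2) * (1 - ‖b‖ ^ 2)) / ((1 - t) * (1 - ‖a‖ ^ 2) + t * (1 - ‖b‖ ^ 2)) ^ 2) t := by
  have h3 := (flipParam_den_pos ha hb ht).ne'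
  have h1 : HasDerivAt (fun t : ℝ => (1 - t) * (1 - ‖a‖ ^ 2)) (-1 * (1 - ‖a‖ ^ 2)) t :=
    ((hasDerivAt_id t).const_sub 1).mul_const _
  have h2 : HasDerivAt (fun t : ℝ => t * (1 - ‖b‖ ^ 2)) (1 * (1 - ‖b‖ ^ 2)) t :=
    (hasDerivAt_id t).mul_const _
  refine (h1.fun_div (h1.fun_add h2) h3).congr_deriv ?_
  congr 1
  ring

theorem halfTurn_midpt {a b : ℂ} (ha : a ∈ disc) (hb : b ∈ disc) {t : ℝ} (ht : t ∈ Icc (0 : ℝ) 1) :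
    halfTurn (midpt a b) (a + t • (b - a)) = a + flipParam a b t • (b - a) := by
  have h1 := Real.sqrt_pos.2 (one_sub_sq_norm_pos ha)
  have h2 := Real.sqrt_pos.2 (one_sub_sq_norm_pos hb)
  have e1 := Real.sq_sqrt (one_sub_sq_norm_pos ha).le
  have e2 := Real.sq_sqrt (one_sub_sq_norm_pos hb).le
  have ka := lor_midpt ha hb
  have kb := lor_midpt hb ha
  rw [midpt_comm b a] at kb
  have h3 := flipParam_den_pos ha hb ht
  have hc : 2 * (lor (a + t • (b - a)) (midpt a b) / lor (midpt a b) (midpt a b)) =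
      (1 - t) * (2 * (lor a (midpt a b) / lor (midpt a b) (midpt a b))) +
        t * (2 * (lor b (midpt a b) / lor (midpt a b) (midpt a b))) := by
    have : lor (a + t • (b - a)) (midpt a b) =
        (1 - t) * lor a (midpt a b) + t * lor b (midpt a b) := by
      simp [lor_eq]; ring
    rw [this]; ring
  rw [ka, kb] at hc
  have hden := turnDen_pos (midpt_mem ha hb) (segmentPoint_mem ha hb ht)
  rw [halfTurn_eq_smul, turnDen, hc]
  rw [turnDen, hc] at hden
  have hf : flipParam a b t = (1 - t) * Real.sqrt (1 - ‖a‖ ^ 2) ^ 2 /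
      ((1 - t) * Real.sqrt (1 - ‖a‖ ^ 2) ^ 2 + t * Real.sqrt (1 - ‖b‖ ^ 2) ^ 2) := by
    rw [e1, e2, flipParam]
  rw [← e1, ← e2] at h3
  rw [hf, midpt_eq]
  set α := Real.sqrt (1 - ‖a‖ ^ 2)
  set β := Real.sqrt (1 - ‖b‖ ^ 2)
  have h4 : (1 - t) * ((α + β) / β) + t * ((β + α) / α) - 1 =
      ((1 - t) * α ^ 2 + t * β ^ 2) / (α * β) := by
    field_simp; ring
  rw [h4]
  apply Complex.ext <;>
  simp only [Complex.smul_re, Complex.smul_im, Complex.add_re, Complex.add_im, Complex.sub_re,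
    Complex.sub_im, smul_eq_mul] <;>
  field_simp <;> ring

theorem halfTurn_midpt_left {a b : ℂ} (ha : a ∈ disc) (hb : b ∈ disc) :
    halfTurn (midpt a b) a = b := by
  have h := halfTurn_midpt ha hb (t := 0) (by simp)
  have h1 := (one_sub_sq_norm_pos ha).ne'
  simpa [flipParam, h1] using h

namespace GeodesicPolygon

variable {n : ℕ} (P : GeodesicPolygon n)

theorem midpt_mem (i : ZMod n) : midpt (P.v i) (P.v (i + 1)) ∈ disc :=
  CxHyp.midpt_mem (P.mem_disc _) (P.mem_disc _)

theorem turn_mem (i : ZMod n) {x : ℂ} (hx : x ∈ disc) : P.turn i x ∈ disc :=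
  halfTurn_mem (P.midpt_mem i) hx

theorem turn_turn (i : ZMod n) {x : ℂ} (hx : x ∈ disc) : P.turn i (P.turn i x) = x :=
  halfTurn_halfTurn (P.midpt_mem i) hx

theorem turn_v (i : ZMod n) : P.turn i (P.v i) = P.v (i + 1) :=
  halfTurn_midpt_left (P.mem_disc _) (P.mem_disc _)

theorem act_append (w w' : List (ZMod n)) (x : ℂ) : P.act (w ++ w') x = P.act w (P.act w' x) := by
  simp [act]

theorem act_mem (w : List (ZMod n)) {x : ℂ} (hx : x ∈ disc) : P.act w x ∈ disc := by
  induction w with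
  | nil => exact hx
  | cons i w ih => exact P.turn_mem i ih

theorem act_reverse_act (w : List (ZMod n)) {x : ℂ} (hx : x ∈ disc) :
    P.act w.reverse (P.act w x) = x := by
  induction w with
  | nil => rfl
  | cons i w ih =>
    rw [List.reverse_cons, act_append]
    have : P.act [i] (P.act (i :: w) x) = P.act w x := P.turn_turn i (P.act_mem w hx)
    rw [this, ih]

theorem contDiffOn_act (w : List (ZMod n)) : ContDiffOn ℝ ∞ (P.act w) disc := by
  induction w with
  | nil => exact contDiffOn_id
  | cons i w ih =>
    exact (contDiffOn_halfTurn (P.midpt_mem i)).comp ih fun x hx => P.act_mem w hx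

end GeodesicPolygon

/-! ### A primitive of the Kähler form along a lift -/

theorem herm_add_right (x y z : V) : herm x (y + z) = herm x y + herm x z := by
  rw [← herm_conj, herm_add_left, map_add, herm_conj, herm_conj]

/-- The hermitian form as a continuous real bilinear map. -/
def hermL : V →L[ℝ] V →L[ℝ] ℂ :=
  LinearMap.toContinuousBilinearMap <| LinearMap.mk₂ ℝ herm herm_add_left
    (fun c x y => by
      have : c • x = (c : ℂ) • x := by ext; simp
      rw [this, herm_smul_left, Complex.real_smul])
    herm_add_right
    (fun c x y => by
      have : c • y = (c : ℂ) • y := by ext; simp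
      rw [this, herm_smul_right, Complex.conj_ofReal, Complex.real_smul])

@[simp] theorem hermL_apply (x y : V) : hermL x y = herm x y := rfl

theorem herm_self_im (p : V) : (herm p p).im = 0 := by
  have := congrArg Complex.im (herm_conj p p)
  rw [Complex.conj_im] at this
  linarith

theorem ofReal_herm_self_re (p : V) : (((herm p p).re : ℝ) : ℂ) = herm p p :=
  Complex.ext rfl (herm_self_im p).symm

theorem IsNegative.herm_self_ne {p : V} (hp : IsNegative p) : herm p p ≠ 0 := by
  intro h; rw [IsNegative, h] at hp; simp at hp

theorem herm_proj_proj {p : V} (hp : herm p p ≠ 0) (a b : V) :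
    herm (proj p a) (proj p b) = herm a b - herm a p * herm p b / herm p p := by
  have hc : conj (herm p p) = herm p p := herm_conj p p
  simp only [proj, herm_sub_left, herm_sub_right, herm_smul_left, herm_smul_right, map_div₀, hc,
    herm_conj]
  field_simp
  ring

theorem tangentHerm_eq {p : V} (hp : herm p p ≠ 0) (a b : V) :
    tangentHerm p a b = -(herm a b / herm p p - herm a p * herm p b / herm p p ^ 2) := by
  have hc : conj (herm p p) = herm p p := herm_conj p p
  rw [tangentHerm, herm_smul_left, herm_smul_right, herm_proj_proj hp, map_inv₀, hc]
  field_simp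

theorem kaehler_eq {p : V} (hp : herm p p ≠ 0) (a b : V) :
    kaehler p a b = (herm a p * herm p b).im / (herm p p).re ^ 2 -
      (herm a b).im / (herm p p).re := by
  rw [kaehler, tangentHerm_eq hp, ← ofReal_herm_self_re p, ← Complex.ofReal_pow]
  rw [Complex.neg_im, Complex.sub_im, Complex.div_ofReal_im, Complex.div_ofReal_im,
    Complex.ofReal_re]
  ring

/-- The Kähler form depends only on the points and tangent vectors that are represented. -/
theorem kaehler_smul_add {p : V} (hp : herm p p ≠ 0) (a b : V) {c : ℂ} (hc : c ≠ 0) (μ ν : ℂ) :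
    kaehler (c • p) (c • a + μ • p) (c • b + ν • p) = kaehler p a b := by
  have hc' : conj c ≠ 0 := (map_ne_zero _).2 hc
  have hcp : herm (c • p) (c • p) ≠ 0 := by
    rw [herm_smul_left, herm_smul_right]; exact mul_ne_zero hc (mul_ne_zero hc' hp)
  rw [kaehler, kaehler, tangentHerm_eq hp, tangentHerm_eq hcp]
  congr 2
  simp only [herm_add_left, herm_add_right, herm_smul_left, herm_smul_right]
  field_simp
  ring

theorem kaehler_map (g : U) (p a b : V) : kaehler (g.1 p) (g.1 a) (g.1 b) = kaehler p a b := by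
  have hg : ∀ x y, herm (g.1 x) (g.1 y) = herm x y := g.2
  have hproj : ∀ a, proj (g.1 p) (g.1 a) = g.1 (proj p a) := fun a => by
    rw [proj, proj, hg, hg, map_sub, map_smul]
  rw [kaehler, kaehler, tangentHerm, tangentHerm, hproj, hproj, hg, ← map_smul, ← map_smul, hg]

theorem kaehler_comp {p : V} (hp : herm p p ≠ 0) (L : ℂ →L[ℝ] V) (z w : ℂ) :
    kaehler p (L z) (L w) = cross z w * kaehler p (L 1) (L Complex.I) := by
  have h : ∀ u : ℂ, L u = (u.re : ℂ) • L 1 + (u.im : ℂ) • L Complex.I := fun u => by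
    have : L u = u.re • L 1 + u.im • L Complex.I := by
      rw [← map_smul, ← map_smul, ← map_add]
      congr 1
      simp [Complex.re_add_im]
    rw [this]
    ext i
    simp
  have e1 := congrArg Complex.im (herm_conj (L 1) (L Complex.I))
  have e2 := fun a => congrArg Complex.im (herm_conj a p)
  have e3 := fun a => congrArg Complex.re (herm_conj a p)
  simp only [Complex.conj_im, Complex.conj_re] at e1 e2 e3
  rw [kaehler_eq hp, kaehler_eq hp, h z, h w]
  simp only [herm_add_left, herm_add_right, herm_smul_left, herm_smul_right, Complex.conj_ofReal,
    Complex.add_im, Complex.add_re, Complex.mul_im, Complex.mul_re, Complex.ofReal_re,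
    Complex.ofReal_im, herm_self_im, ← e1, ← e2, ← e3, cross]
  ring

/-- The one-form `Im ⟨dF, F⟩ / ⟨F, F⟩` attached to a lift `F` of a map to `𝔹`: the connection
form of the tautological bundle. -/
def liftForm (F : ℂ → V) (x : ℂ) : ℂ →L[ℝ] ℝ :=
  (herm (F x) (F x)).re⁻¹ • Complex.imCLM.comp ((hermL.flip (F x)).comp (fderiv ℝ F x))

theorem liftForm_apply (F : ℂ → V) (x v : ℂ) :
    liftForm F x v = (herm (fderiv ℝ F x v) (F x)).im / (herm (F x) (F x)).re := by
  simp [liftForm, div_eq_inv_mul]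

theorem contDiffOn_liftForm {F : ℂ → V} (hF : ContDiffOn ℝ ∞ F disc)
    (hneg : ∀ x ∈ disc, IsNegative (F x)) : ContDiffOn ℝ 1 (liftForm F) disc := by
  have h1 : ContDiffOn ℝ 1 F disc := hF.of_le (by exact_mod_cast le_top)
  have h2 : ContDiffOn ℝ 1 (fderiv ℝ F) disc :=
    hF.fderiv_of_isOpen isOpen_disc (by rw [one_add_one_eq_two]; exact ENat.LEInfty.out)
  have h3 : ContDiffOn ℝ 1 (fun x => (hermL (F x) (F x)).re) disc :=
    Complex.reCLM.contDiff.comp_contDiffOn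
      ((hermL.contDiff.comp_contDiffOn h1).clm_apply h1)
  have h4 : ContDiffOn ℝ 1 (fun x => hermL.flip (F x)) disc :=
    hermL.flip.contDiff.comp_contDiffOn h1
  exact (h3.inv fun x hx => (hneg x hx).ne).smul (contDiffOn_const.clm_comp (h4.clm_comp h2))

/-- The connection form is a primitive of twice the pull-back of the Kähler form. -/
theorem curl_liftForm {F : ℂ → V} (hF : ContDiffOn ℝ ∞ F disc)
    (hneg : ∀ x ∈ disc, IsNegative (F x)) {x : ℂ} (hx : x ∈ disc) :
    curl (liftForm F) x = 2 * pullbackKaehler F x := by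
  have hnx := isOpen_disc.mem_nhds hx
  have hFx : ContDiffAt ℝ ∞ F x := hF.contDiffAt hnx
  have d1 : HasFDerivAt F (fderiv ℝ F x) x := (hFx.differentiableAt (by simp)).hasFDerivAt
  have d2 : HasFDerivAt (fderiv ℝ F) (fderiv ℝ (fderiv ℝ F) x) x :=
    ((hFx.fderiv_right (m := 1) (by rw [one_add_one_eq_two]; exact ENat.LEInfty.out)).differentiableAt
      (by simp)).hasFDerivAt
  have hη : HasFDerivAt (liftForm F) (fderiv ℝ (liftForm F) x) x :=
    (((contDiffOn_liftForm hF hneg).contDiffAt hnx).differentiableAt (by simp)).hasFDerivAt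
  have hN : (herm (F x) (F x)).re ≠ 0 := (hneg x hx).ne
  have dN := Complex.reCLM.hasFDerivAt.comp x ((hermL.hasFDerivAt.comp x d1).clm_apply d1)
  have dNi := (hasDerivAt_inv hN).comp_hasFDerivAt x dN
  have key : ∀ u v : ℂ, fderiv ℝ (liftForm F) x u v =
      ((herm (fderiv ℝ (fderiv ℝ F) x u v) (F x)).im +
        (herm (fderiv ℝ F x v) (fderiv ℝ F x u)).im) / (herm (F x) (F x)).re -
      (herm (fderiv ℝ F x v) (F x)).im * (2 * (herm (fderiv ℝ F x u) (F x)).re) /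
        (herm (F x) (F x)).re ^ 2 := fun u v => by
    have h1 : HasFDerivAt (fun y => liftForm F y v)
        ((ContinuousLinearMap.apply ℝ ℝ v).comp (fderiv ℝ (liftForm F) x)) x :=
      (ContinuousLinearMap.apply ℝ ℝ v).hasFDerivAt.comp x hη
    have dv : HasFDerivAt (fun y => fderiv ℝ F y v)
        ((ContinuousLinearMap.apply ℝ V v).comp (fderiv ℝ (fderiv ℝ F) x)) x :=
      (ContinuousLinearMap.apply ℝ V v).hasFDerivAt.comp x d2
    have h2 := dNi.mul
      (Complex.imCLM.hasFDerivAt.comp x ((hermL.hasFDerivAt.comp x dv).clm_apply d1))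
    have h3 := congrArg (fun L : ℂ →L[ℝ] ℝ => L u) (h1.unique (h2.congr_of_eventuallyEq
      (Eventually.of_forall fun y => (liftForm_apply F y v).trans (div_eq_inv_mul _ _))))
    have e3 := congrArg Complex.re (herm_conj (fderiv ℝ F x u) (F x))
    rw [Complex.conj_re] at e3
    simp only [ContinuousLinearMap.comp_apply, ContinuousLinearMap.apply_apply,
      _root_.add_apply, _root_.smul_apply, ContinuousLinearMap.flip_apply, Function.comp_apply,
      Complex.imCLM_apply, Complex.reCLM_apply, hermL_apply, smul_eq_mul, Complex.add_im,
      Complex.add_re] at h3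
    rw [h3, ← e3]
    field_simp
    ring
  have hsymm : fderiv ℝ (fderiv ℝ F) x 1 Complex.I = fderiv ℝ (fderiv ℝ F) x Complex.I 1 :=
    (hFx.isSymmSndFDerivAt (by simpa using ENat.LEInfty.out)) 1 Complex.I
  have e1 := congrArg Complex.im (herm_conj (fderiv ℝ F x 1) (fderiv ℝ F x Complex.I))
  have e2 := congrArg Complex.im (herm_conj (fderiv ℝ F x Complex.I) (F x))
  have e3 := congrArg Complex.re (herm_conj (fderiv ℝ F x Complex.I) (F x))
  rw [Complex.conj_im] at e1 e2
  rw [Complex.conj_re] at e3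
  rw [curl, key, key, pullbackKaehler, kaehler_eq (hneg x hx).herm_self_ne, Complex.mul_im, ← e2,
    ← e3, ← e1, hsymm]
  ring

theorem pullbackKaehler_comp {F : ℂ → V} (hF : ContDiffOn ℝ ∞ F disc)
    (hneg : ∀ x ∈ disc, IsNegative (F x)) {T : ℂ → ℂ} {x : ℂ} (hT : DifferentiableAt ℝ T x)
    (hx : T x ∈ disc) :
    pullbackKaehler (F ∘ T) x = (fderiv ℝ T x).det * pullbackKaehler F (T x) := by
  have hFx : DifferentiableAt ℝ F (T x) :=
    (hF.contDiffAt (isOpen_disc.mem_nhds hx)).differentiableAt (by simp)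
  rw [pullbackKaehler, fderiv_comp x hFx hT, det_eq_cross]
  exact kaehler_comp (hneg _ hx).herm_self_ne (fderiv ℝ F (T x)) (fderiv ℝ T x 1)
    (fderiv ℝ T x Complex.I)

/-- The pull-back of the Kähler form depends neither on the lift nor on a unitary change of
coordinates. -/
theorem pullbackKaehler_smul {F : ℂ → V} {x : ℂ} (hF : DifferentiableAt ℝ F x)
    (hneg : IsNegative (F x)) {c : ℂ → ℂ} (hc : DifferentiableAt ℝ c x) (hc0 : c x ≠ 0) (g : U) :
    pullbackKaehler (fun y => c y • g.1 (F y)) x = pullbackKaehler F x := by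
  obtain ⟨gL, hgL⟩ : ∃ gL : V →L[ℝ] V, ∀ x, g.1 x = gL x :=
    ⟨(g.1.toLinearMap.restrictScalars ℝ).toContinuousLinearMap, fun _ => rfl⟩
  have hinv : ∀ p a b, kaehler (gL p) (gL a) (gL b) = kaehler p a b := fun p a b => by
    rw [← hgL, ← hgL, ← hgL, kaehler_map]
  have hp : herm (gL (F x)) (gL (F x)) ≠ 0 := by
    rw [← hgL]
    exact (g.2 (F x) (F x)).trans_ne hneg.herm_self_ne
  simp only [hgL]
  have h := hc.hasFDerivAt.smul (gL.hasFDerivAt.comp x hF.hasFDerivAt)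
  have h' : fderiv ℝ (fun y => c y • gL (F y)) x = c x • gL.comp (fderiv ℝ F x) +
      (fderiv ℝ c x).smulRight (gL (F x)) := h.fderiv
  rw [pullbackKaehler, h', pullbackKaehler, ← hinv (F x)]
  exact kaehler_smul_add hp _ _ hc0 _ _

/-- The absolute value in the change of variables formula disappears since half-turns preserve the
orientation. -/
theorem integral_image_pullbackKaehler {F : ℂ → V} (hF : ContDiffOn ℝ ∞ F disc)
    (hneg : ∀ x ∈ disc, IsNegative (F x)) {m : ℂ} (hm : m ∈ disc) {S : Set ℂ}
    (hS : MeasurableSet S) (hSd : S ⊆ disc) :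
    ∫ x in halfTurn m '' S, pullbackKaehler F x = ∫ x in S, pullbackKaehler (F ∘ halfTurn m) x := by
  have hd : ∀ x ∈ disc, DifferentiableAt ℝ (halfTurn m) x := fun x hx =>
    ((contDiffOn_halfTurn hm).contDiffAt (isOpen_disc.mem_nhds hx)).differentiableAt (by simp)
  rw [integral_image_eq_integral_abs_det_fderiv_smul volume hS
    (fun x hx => (hd x (hSd hx)).hasFDerivAt.hasFDerivWithinAt)
    (fun x hx y hy h => by
      rw [← halfTurn_halfTurn hm (hSd hx), h, halfTurn_halfTurn hm (hSd hy)])]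
  refine setIntegral_congr_fun hS fun x hx => ?_
  have hx' := hSd hx
  rw [pullbackKaehler_comp hF hneg (hd x hx') (halfTurn_mem hm hx'), smul_eq_mul,
    abs_of_pos]
  rw [det_fderiv_halfTurn hm hx']
  have := turnDen_pos hm hx'
  positivity

namespace GeodesicPolygon

variable {n : ℕ} (P : GeodesicPolygon n)

theorem integral_act_image {F : ℂ → V} (hF : ContDiffOn ℝ ∞ F disc)
    (hneg : ∀ x ∈ disc, IsNegative (F x)) (w : List (ZMod n)) {S : Set ℂ}
    (hS : MeasurableSet S) (hSd : S ⊆ disc) :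
    ∫ x in P.act w '' S, pullbackKaehler F x = ∫ x in S, pullbackKaehler (F ∘ P.act w) x := by
  induction w generalizing F with
  | nil =>
    have : P.act [] = id := rfl
    simp [this]
  | cons i w ih =>
    have e : P.act (i :: w) = P.turn i ∘ P.act w := rfl
    have hinj : InjOn (P.act w) disc := fun x hx y hy h => by
      rw [← P.act_reverse_act w hx, h, P.act_reverse_act w hy]
    have hm : MeasurableSet (P.act w '' S) :=
      hS.image_of_continuousOn_injOn ((P.contDiffOn_act w).continuousOn.mono hSd) (hinj.mono hSd)
    have hsub : P.act w '' S ⊆ disc := by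
      rintro _ ⟨x, hx, rfl⟩; exact P.act_mem w (hSd hx)
    rw [e, image_comp]
    have := integral_image_pullbackKaehler hF hneg (P.midpt_mem i) hm hsub
    refine this.trans (ih ?_ ?_)
    · exact hF.comp (contDiffOn_halfTurn (P.midpt_mem i)) fun x hx => P.turn_mem i hx
    · exact fun x hx => hneg _ (P.turn_mem i hx)

/-- The integral over the polygon of the pull-back of the Kähler form is half the integral of the
connection form along the boundary. -/
theorem integral_pullbackKaehler (hn : 2 ≤ n) {F : ℂ → V} (hF : ContDiffOn ℝ ∞ F disc)
    (hneg : ∀ x ∈ disc, IsNegative (F x)) :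
    2 * ∫ x in P.region, pullbackKaehler F x =
      ∑ k ∈ Finset.range n, edgeIntegral (liftForm F) (P.v k) (P.v ((k : ZMod n) + 1)) := by
  have : NeZero n := ⟨by omega⟩
  rw [← P.integral_curl hn (contDiffOn_liftForm hF hneg), ← integral_const_mul]
  exact setIntegral_congr_fun P.measurableSet_region fun x hx =>
    (curl_liftForm hF hneg (P.region_subset_disc hx)).symm

end GeodesicPolygon

/-! ### Kähler potentials along the edges -/

theorem isNegative_iff {p : V} : IsNegative p ↔ ‖p 0‖ ^ 2 + ‖p 1‖ ^ 2 < ‖p 2‖ ^ 2 := by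
  have : (herm p p).re = ‖p 0‖ ^ 2 + ‖p 1‖ ^ 2 - ‖p 2‖ ^ 2 := by
    simp only [herm, Complex.mul_conj, Complex.normSq_eq_norm_sq]
    norm_cast
  rw [IsNegative, this, sub_neg]

theorem IsNegative.coord_ne {p : V} (hp : IsNegative p) : p 2 ≠ 0 := by
  intro h
  rw [isNegative_iff, h] at hp
  have h1 := sq_nonneg ‖p 0‖
  have h2 := sq_nonneg ‖p 1‖
  simp at hp
  linarith

theorem IsNegative.smul {p : V} (hp : IsNegative p) {c : ℂ} (hc : c ≠ 0) : IsNegative (c • p) := by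
  rw [isNegative_iff] at *
  simp only [Pi.smul_apply, smul_eq_mul, norm_mul, mul_pow]
  have : 0 < ‖c‖ ^ 2 := by positivity
  nlinarith

theorem IsNegative.map {p : V} (hp : IsNegative p) (g : U) : IsNegative (g.1 p) := by
  have : herm (g.1 p) (g.1 p) = herm p p := g.2 p p
  rw [IsNegative, this]; exact hp

/-- The triple product `⟨p, y⟩ ⟨y, e⟩ ⟨e, p⟩` of negative vectors has negative real part; here `e` is
the third basis vector, for which `⟨y, e⟩ ⟨e, p⟩ = y 2 * conj (p 2)`. -/
theorem cartan_re_pos {p y : V} (hp : IsNegative p) (hy : IsNegative y) :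
    0 < (-(herm p y * y 2 * conj (p 2))).re := by
  rw [isNegative_iff] at hp hy
  have e : -(herm p y * y 2 * conj (p 2)) = ((‖p 2‖ ^ 2 * ‖y 2‖ ^ 2 : ℝ) : ℂ) -
      (p 0 * conj (y 0) + p 1 * conj (y 1)) * (y 2 * conj (p 2)) := by
    rw [herm, ← Complex.normSq_eq_norm_sq, ← Complex.normSq_eq_norm_sq, Complex.ofReal_mul,
      ← Complex.mul_conj, ← Complex.mul_conj]
    ring
  have h1 : ((p 0 * conj (y 0) + p 1 * conj (y 1)) * (y 2 * conj (p 2))).re ≤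
      (‖p 0‖ * ‖y 0‖ + ‖p 1‖ * ‖y 1‖) * (‖y 2‖ * ‖p 2‖) := by
    refine (Complex.re_le_norm _).trans ?_
    rw [norm_mul, norm_mul, Complex.norm_conj]
    gcongr
    refine (norm_add_le _ _).trans ?_
    simp
  have hp2 : 0 < ‖p 2‖ := by
    by_contra h
    have : ‖p 2‖ = 0 := le_antisymm (not_lt.1 h) (norm_nonneg _)
    rw [this] at hp; nlinarith [sq_nonneg ‖p 0‖, sq_nonneg ‖p 1‖]
  have hy2 : 0 < ‖y 2‖ := by
    by_contra h
    have : ‖y 2‖ = 0 := le_antisymm (not_lt.1 h) (norm_nonneg _)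
    rw [this] at hy; nlinarith [sq_nonneg ‖y 0‖, sq_nonneg ‖y 1‖]
  have h2 : ‖p 0‖ * ‖y 0‖ + ‖p 1‖ * ‖y 1‖ < ‖p 2‖ * ‖y 2‖ := by
    refine lt_of_pow_lt_pow_left₀ 2 (by positivity) ?_
    calc (‖p 0‖ * ‖y 0‖ + ‖p 1‖ * ‖y 1‖) ^ 2
        ≤ (‖p 0‖ ^ 2 + ‖p 1‖ ^ 2) * (‖y 0‖ ^ 2 + ‖y 1‖ ^ 2) := by
          nlinarith [sq_nonneg (‖p 0‖ * ‖y 1‖ - ‖p 1‖ * ‖y 0‖)]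
      _ < ‖p 2‖ ^ 2 * ‖y 2‖ ^ 2 := mul_lt_mul'' hp hy (by positivity) (by positivity)
      _ = (‖p 2‖ * ‖y 2‖) ^ 2 := by ring
  have h3 := mul_lt_mul_of_pos_right h2 (mul_pos hy2 hp2)
  rw [e, Complex.sub_re, Complex.ofReal_re]
  nlinarith

theorem herm_ne_zero {p y : V} (hp : IsNegative p) (hy : IsNegative y) : herm p y ≠ 0 := by
  intro h
  have := cartan_re_pos hp hy
  simp [h] at this

/-- The argument of `⟨p, y⟩ ⟨y, e⟩ ⟨e, p⟩`, up to sign, where `e` is the third basis vector. As `p`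
runs over a path of vectors with third coordinate `1`, it is a continuous argument of
`⟨p, y⟩` up to an additive constant. -/
def cartanArg (y p : V) : ℝ := Complex.arg (-(herm p y * y 2 * conj (p 2)))

theorem cartanArg_smul (y p : V) {c : ℂ} (hc : c ≠ 0) : cartanArg y (c • p) = cartanArg y p := by
  have : -(herm (c • p) y * y 2 * conj ((c • p) 2)) =
      (Complex.normSq c : ℂ) * -(herm p y * y 2 * conj (p 2)) := by
    rw [herm_smul_left, Pi.smul_apply, smul_eq_mul, map_mul, ← Complex.mul_conj]; ring
  rw [cartanArg, this, Complex.arg_real_mul _ (Complex.normSq_pos.2 hc), cartanArg]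

/-- The Kähler potential with base point `y`, evaluated at the tangent vector represented by `a`
at the point represented by `p`. Unlike the connection form, it does not depend on the choice of
representatives. -/
def potential (y p a : V) : ℝ := (herm a p / herm p p - herm a y / herm p y).im

theorem potential_smul_add {y p : V} (a : V) (hp : herm p p ≠ 0) (hy : herm p y ≠ 0) {c : ℂ}
    (hc : c ≠ 0) (μ : ℂ) : potential y (c • p) (c • a + μ • p) = potential y p a := by
  have hc' : conj c ≠ 0 := (map_ne_zero _).2 hc
  rw [potential, potential]
  congr 1
  simp only [herm_add_left, herm_smul_left, herm_smul_right]
  field_simp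
  ring

theorem potential_smul_right (y p a : V) (s : ℝ) :
    potential y p (s • a) = s * potential y p a := by
  have : s • a = (s : ℂ) • a := by ext; simp
  rw [this, potential, potential, herm_smul_left, herm_smul_left, mul_div_assoc, mul_div_assoc,
    ← mul_sub, Complex.im_ofReal_mul]

theorem herm_refl_left {m y : V} (hy : herm y m = 0) (x : V) :
    herm ((refl m).1 x) y = -herm x y := by
  have hry : (refl m).1 y = (-1 : ℂ) • y := by
    show reflLin m y = _
    rw [reflLin_apply, hy]; simp
  have h : herm ((refl m).1 x) ((refl m).1 y) = herm x y := (refl m).2 x y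
  rw [hry, herm_smul_right] at h
  simp at h
  rw [← h, neg_neg]

theorem potential_refl {m y : V} (hy : herm y m = 0) (p a : V) :
    potential y ((refl m).1 p) ((refl m).1 a) = potential y p a := by
  have hg : ∀ x z, herm ((refl m).1 x) ((refl m).1 z) = herm x z := (refl m).2
  rw [potential, hg, hg, herm_refl_left hy, herm_refl_left hy, neg_div_neg_eq, potential]

/-- A positive vector has a negative vector in its orthogonal complement. -/
theorem exists_isNegative_orthogonal {m : V} (hm : IsPositive m) :
    ∃ y, IsNegative y ∧ herm y m = 0 := by
  have hm0 : herm m m ≠ 0 := fun h => by rw [IsPositive, h] at hm; simp at hm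
  let e : V := ![0, 0, 1]
  have he : herm e e = -1 := by simp [e, herm]
  refine ⟨proj m e, ?_, ?_⟩
  · rw [IsNegative, herm_proj_proj hm0, he, ← herm_conj e m, Complex.mul_conj,
      ← ofReal_herm_self_re m, ← Complex.ofReal_div]
    simp only [Complex.sub_re, Complex.neg_re, Complex.one_re, Complex.ofReal_re]
    have := div_nonneg (Complex.normSq_nonneg (herm e m)) (le_of_lt hm)
    linarith
  · rw [proj, herm_sub_left, herm_smul_left, div_mul_cancel₀ _ hm0, sub_self]

/-- A smooth lift of a map to `𝔹`, normalized by the condition that its third coordinate is `1`. -/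
structure IsNormalizedLift (F : ℂ → V) : Prop where
  smooth : ContDiffOn ℝ ∞ F disc
  negative : ∀ x ∈ disc, IsNegative (F x)
  coord : ∀ x ∈ disc, F x 2 = 1

namespace IsNormalizedLift

variable {F : ℂ → V}

theorem hasFDerivAt (hF : IsNormalizedLift F) {x : ℂ} (hx : x ∈ disc) :
    HasFDerivAt F (fderiv ℝ F x) x :=
  ((hF.smooth.contDiffAt (isOpen_disc.mem_nhds hx)).differentiableAt (by simp)).hasFDerivAt

theorem hasDerivAt_edge (hF : IsNormalizedLift F) {a b : ℂ} (ha : a ∈ disc) (hb : b ∈ disc)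
    {t : ℝ} (ht : t ∈ Icc (0 : ℝ) 1) :
    HasDerivAt (fun t : ℝ => F (a + t • (b - a))) (fderiv ℝ F (a + t • (b - a)) (b - a)) t := by
  have h : HasDerivAt (fun t : ℝ => a + t • (b - a)) ((1 : ℝ) • (b - a)) t :=
    ((hasDerivAt_id t).smul_const (b - a)).const_add a
  rw [one_smul] at h
  exact (hF.hasFDerivAt (segmentPoint_mem ha hb ht)).comp_hasDerivAt t h

theorem continuousOn_edge (hF : IsNormalizedLift F) {a b : ℂ} (ha : a ∈ disc) (hb : b ∈ disc) :
    ContinuousOn (fun t : ℝ => F (a + t • (b - a))) (Icc 0 1) :=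
  fun _ ht => (hF.hasDerivAt_edge ha hb ht).continuousAt.continuousWithinAt

theorem continuousOn_deriv_edge (hF : IsNormalizedLift F) {a b : ℂ} (ha : a ∈ disc)
    (hb : b ∈ disc) :
    ContinuousOn (fun t : ℝ => fderiv ℝ F (a + t • (b - a)) (b - a)) (Icc 0 1) := by
  have h := hF.smooth.continuousOn_fderiv_of_isOpen isOpen_disc ENat.LEInfty.out
  have h2 : ContinuousOn (fun t : ℝ => a + t • (b - a)) (Icc 0 1) := by fun_prop
  exact (h.comp h2 fun t ht => segmentPoint_mem ha hb ht).clm_apply continuousOn_const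

end IsNormalizedLift

theorem continuousOn_herm {f g : ℝ → V} {S : Set ℝ} (hf : ContinuousOn f S)
    (hg : ContinuousOn g S) : ContinuousOn (fun t => herm (f t) (g t)) S :=
  (hermL.continuous.comp_continuousOn hf).clm_apply hg

namespace IsNormalizedLift

variable {F : ℂ → V}

/-- The Kähler potential with base point `y` along the image under `F` of the segment from `a`
to `b`. -/
def edgePotential (y : V) (F : ℂ → V) (a b : ℂ) (t : ℝ) : ℝ :=
  potential y (F (a + t • (b - a))) (fderiv ℝ F (a + t • (b - a)) (b - a))

theorem continuousOn_edgePotential (hF : IsNormalizedLift F) {y : V} (hy : IsNegative y) {a b : ℂ}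
    (ha : a ∈ disc) (hb : b ∈ disc) : ContinuousOn (edgePotential y F a b) (Icc 0 1) := by
  have h1 := hF.continuousOn_edge ha hb
  have h2 := hF.continuousOn_deriv_edge ha hb
  have hn : ∀ t ∈ Icc (0 : ℝ) 1, IsNegative (F (a + t • (b - a))) := fun t ht =>
    hF.negative _ (segmentPoint_mem ha hb ht)
  refine Complex.continuous_im.comp_continuousOn (ContinuousOn.sub ?_ ?_)
  · exact (continuousOn_herm h2 h1).div (continuousOn_herm h1 h1) fun t ht =>
      (hn t ht).herm_self_ne
  · exact (continuousOn_herm h2 continuousOn_const).div (continuousOn_herm h1 continuousOn_const)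
      fun t ht => herm_ne_zero (hn t ht) hy

/-- Along an edge, the connection form of a normalized lift is the Kähler potential with base point
`y` plus the differential of the argument of `⟨F, y⟩`. -/
theorem edgeIntegral_liftForm (hF : IsNormalizedLift F) {y : V} (hy : IsNegative y) {a b : ℂ}
    (ha : a ∈ disc) (hb : b ∈ disc) :
    edgeIntegral (liftForm F) a b = (∫ t in (0 : ℝ)..1, edgePotential y F a b t) +
      (cartanArg y (F b) - cartanArg y (F a)) := by
  have h1 := hF.continuousOn_edge ha hb
  have h2 := hF.continuousOn_deriv_edge ha hb
  have hn : ∀ t ∈ Icc (0 : ℝ) 1, IsNegative (F (a + t • (b - a))) := fun t ht =>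
    hF.negative _ (segmentPoint_mem ha hb ht)
  have hy2 := hy.coord_ne
  let q : ℝ → ℝ := fun t => (herm (fderiv ℝ F (a + t • (b - a)) (b - a)) y /
    herm (F (a + t • (b - a))) y).im
  have hq : ContinuousOn q (Icc 0 1) :=
    Complex.continuous_im.comp_continuousOn ((continuousOn_herm h2 continuousOn_const).div
      (continuousOn_herm h1 continuousOn_const) fun t ht => herm_ne_zero (hn t ht) hy)
  have hd : ∀ t ∈ uIcc (0 : ℝ) 1, HasDerivAt
      (fun t : ℝ => (Complex.log (-(herm (F (a + t • (b - a))) y * y 2))).im) (q t) t := by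
    intro t ht
    rw [uIcc_of_le zero_le_one] at ht
    have e1 : HasDerivAt (fun t : ℝ => herm (F (a + t • (b - a))) y)
        (herm (fderiv ℝ F (a + t • (b - a)) (b - a)) y) t :=
      (hermL.flip y).hasFDerivAt.comp_hasDerivAt t (hF.hasDerivAt_edge ha hb ht)
    have hs : -(herm (F (a + t • (b - a))) y * y 2) ∈ Complex.slitPlane := by
      refine Or.inl ?_
      have := cartan_re_pos (hn t ht) hy
      rwa [hF.coord _ (segmentPoint_mem ha hb ht), map_one, mul_one] at this
    have e2 := ((e1.mul_const (y 2)).fun_neg.clog_real hs)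
    have e3 := Complex.imCLM.hasFDerivAt.comp_hasDerivAt t e2
    refine e3.congr_deriv ?_
    simp only [q, Complex.imCLM_apply]
    congr 1
    have := herm_ne_zero (hn t ht) hy
    field_simp
  have hint := intervalIntegral.integral_eq_sub_of_hasDerivAt hd
    (by rw [← uIcc_of_le (zero_le_one (α := ℝ))] at hq; exact hq.intervalIntegrable)
  have hcart : ∀ x ∈ disc, (Complex.log (-(herm (F x) y * y 2))).im = cartanArg y (F x) :=
    fun x hx => by rw [Complex.log_im, cartanArg, hF.coord x hx, map_one, mul_one]
  simp only [one_smul, zero_smul, add_zero, add_sub_cancel, hcart a ha, hcart b hb] at hint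
  rw [← hint, ← intervalIntegral.integral_add, edgeIntegral]
  · refine intervalIntegral.integral_congr fun t _ => ?_
    simp only [q, edgePotential, potential, Complex.sub_im, sub_add_cancel]
    rw [liftForm_apply]
    conv_rhs => rw [← ofReal_herm_self_re, Complex.div_ofReal_im]
  · refine ContinuousOn.intervalIntegrable ?_
    rw [uIcc_of_le zero_le_one]
    exact hF.continuousOn_edgePotential hy ha hb
  · refine ContinuousOn.intervalIntegrable ?_
    rwa [uIcc_of_le zero_le_one]

/-- A half-turn about the midpoint of an edge that is intertwined with a reflection fixing the base
point reverses the Kähler potential along the edge. -/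
theorem edgePotential_flip {G : ℂ → V} (hF : IsNormalizedLift F) (hG : IsNormalizedLift G)
    {m y : V} (hy : IsNegative y) (hym : herm y m = 0) {a b : ℂ} (ha : a ∈ disc) (hb : b ∈ disc)
    (h : ∀ x ∈ disc, ∃ c : ℂ, F (halfTurn (midpt a b) x) = c • (refl m).1 (G x)) {t : ℝ}
    (ht : t ∈ Ioo (0 : ℝ) 1) :
    edgePotential y F a b (flipParam a b t) * deriv (flipParam a b) t =
      edgePotential y G a b t := by
  have ht' := Ioo_subset_Icc_self ht
  obtain ⟨gL, hgL⟩ : ∃ gL : V →L[ℝ] V, ∀ x, (refl m).1 x = gL x :=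
    ⟨((refl m).1.toLinearMap.restrictScalars ℝ).toContinuousLinearMap, fun _ => rfl⟩
  have hgs : ∀ (c : ℂ) x, gL (c • x) = c • gL x := fun c x => by
    rw [← hgL, ← hgL, map_smul]
  set γ : ℝ → ℂ := fun t => a + t • (b - a) with hγ
  set s := flipParam a b t with hs
  have hs' : s ∈ Icc (0 : ℝ) 1 := flipParam_mem ha hb ht'
  have hσ := hasDerivAt_flipParam ha hb ht'
  have hnG := hG.negative _ (segmentPoint_mem ha hb ht')
  have hRG : IsNegative (gL (G (γ t))) := by rw [← hgL]; exact hnG.map _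
  -- The factor between the two lifts is determined by the normalization.
  have hev : (fun t => F (γ (flipParam a b t))) =ᶠ[𝓝 t]
      fun t => (gL (G (γ t)) 2)⁻¹ • gL (G (γ t)) := by
    filter_upwards [Icc_mem_nhds ht.1 ht.2] with r hr
    obtain ⟨c, hc⟩ := h _ (segmentPoint_mem ha hb hr)
    rw [halfTurn_midpt ha hb hr] at hc
    have h1 := congrFun hc 2
    rw [hF.coord _ (segmentPoint_mem ha hb (flipParam_mem ha hb hr)), hgL, Pi.smul_apply,
      smul_eq_mul] at h1
    rw [hgL, eq_inv_of_mul_eq_one_left h1.symm] at hc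
    exact hc
  have d1 : HasDerivAt (fun t => F (γ (flipParam a b t)))
      (deriv (flipParam a b) t • fderiv ℝ F (γ s) (b - a)) t := by
    rw [hσ.deriv]
    exact (hF.hasDerivAt_edge ha hb hs').scomp t hσ
  have d2 : HasDerivAt (fun t => gL (G (γ t))) (gL (fderiv ℝ G (γ t) (b - a))) t :=
    gL.hasFDerivAt.comp_hasDerivAt t (hG.hasDerivAt_edge ha hb ht')
  have d3 : HasDerivAt (fun t => gL (G (γ t)) 2) (gL (fderiv ℝ G (γ t) (b - a)) 2) t :=
    hasDerivAt_pi.1 d2 2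
  obtain ⟨μ, hμ⟩ : ∃ μ : ℂ, HasDerivAt (fun t => (gL (G (γ t)) 2)⁻¹) μ t :=
    ⟨_, d3.fun_inv hRG.coord_ne⟩
  have d4 := hμ.fun_smul d2
  have e := d1.unique (d4.congr_of_eventuallyEq hev)
  have e0 := hev.self_of_nhds
  have hc0 : (gL (G (γ t)) 2)⁻¹ ≠ 0 := inv_ne_zero hRG.coord_ne
  rw [edgePotential, mul_comm, ← potential_smul_right]
  simp only [hγ] at e e0
  rw [← hs] at e0
  rw [e, e0, potential_smul_add _ hRG.herm_self_ne (herm_ne_zero hRG hy) hc0, ← hgL, ← hgL,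
    potential_refl hym, edgePotential]

/-- If the half-turn about the midpoint of an edge permutes the members of a family of maps up to a
reflection fixing the base point `y`, then the potentials cancel along the edge, because the
half-turn reverses it. Only the variation of the argument of `⟨-, y⟩` remains. -/
theorem sum_edgeIntegral {ι : Type*} [Fintype ι] {Φ : ι → ℂ → V} (hΦ : ∀ u, IsNormalizedLift (Φ u))
    (σ : Equiv.Perm ι) {m y : V} (hy : IsNegative y) (hym : herm y m = 0) {a b : ℂ}
    (ha : a ∈ disc) (hb : b ∈ disc)
    (h : ∀ u, ∀ x ∈ disc, ∃ c : ℂ, Φ u (halfTurn (midpt a b) x) = c • (refl m).1 (Φ (σ u) x)) :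
    ∑ u, edgeIntegral (liftForm (Φ u)) a b =
      ∑ u, (cartanArg y (Φ u b) - cartanArg y (Φ u a)) := by
  have hI : ∀ u, ∫ t in (0 : ℝ)..1, edgePotential y (Φ (σ u)) a b t =
      -∫ t in (0 : ℝ)..1, edgePotential y (Φ u) a b t := fun u => by
    have h0 : flipParam a b 0 = 1 := by simp [flipParam, (one_sub_sq_norm_pos ha).ne']
    have h1 : flipParam a b 1 = 0 := by simp [flipParam]
    have hd : ∀ t ∈ Icc (0 : ℝ) 1, HasDerivAt (flipParam a b) (deriv (flipParam a b) t) t :=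
      fun t ht => (hasDerivAt_flipParam ha hb ht).differentiableAt.hasDerivAt
    have hcd : ContinuousOn (deriv (flipParam a b)) (Icc 0 1) := by
      refine ContinuousOn.congr (f := fun t => -((1 - ‖a‖ ^ 2) * (1 - ‖b‖ ^ 2)) /
        ((1 - t) * (1 - ‖a‖ ^ 2) + t * (1 - ‖b‖ ^ 2)) ^ 2) ?_
        fun t ht => (hasDerivAt_flipParam ha hb ht).deriv
      exact ContinuousOn.div (by fun_prop) (by fun_prop)
        fun t ht => pow_ne_zero 2 (flipParam_den_pos ha hb ht).ne'
    have hsub := intervalIntegral.integral_comp_mul_deriv'' (a := 0) (b := 1)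
      (f := flipParam a b) (f' := deriv (flipParam a b)) (g := edgePotential y (Φ u) a b)
      (by rw [uIcc_of_le zero_le_one]
          exact fun t ht => (hd t ht).continuousAt.continuousWithinAt)
      (fun t ht => (hd t (by simpa using Ioo_subset_Icc_self ht)).hasDerivWithinAt)
      (by rwa [uIcc_of_le zero_le_one])
      (by rw [uIcc_of_le zero_le_one]
          refine ((hΦ u).continuousOn_edgePotential hy ha hb).mono ?_
          rintro _ ⟨t, ht, rfl⟩
          exact flipParam_mem ha hb ht)
    rw [h0, h1] at hsub
    rw [← intervalIntegral.integral_symm, ← hsub, intervalIntegral.integral_of_le zero_le_one,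
      intervalIntegral.integral_of_le zero_le_one, integral_Ioc_eq_integral_Ioo,
      integral_Ioc_eq_integral_Ioo]
    exact setIntegral_congr_fun measurableSet_Ioo fun t ht =>
      (edgePotential_flip (hΦ u) (hΦ (σ u)) hy hym ha hb (h u) ht).symm
  have hsum : ∑ u, ∫ t in (0 : ℝ)..1, edgePotential y (Φ u) a b t = 0 := by
    have h1 : ∑ u, ∫ t in (0 : ℝ)..1, edgePotential y (Φ (σ u)) a b t =
        ∑ u, ∫ t in (0 : ℝ)..1, edgePotential y (Φ u) a b t :=
      Equiv.sum_comp σ fun u => ∫ t in (0 : ℝ)..1, edgePotential y (Φ u) a b t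
    rw [Finset.sum_congr rfl fun u _ => hI u, Finset.sum_neg_distrib] at h1
    linarith
  rw [Finset.sum_congr rfl fun u _ => (hΦ u).edgeIntegral_liftForm hy ha hb,
    Finset.sum_add_distrib, hsum, zero_add]

end IsNormalizedLift

/-! ### The total variation of the argument along the cycle -/

variable {n : ℕ}

/-- The partial product `f k * ⋯ * f 2 * f 1`. -/
def partialProd {G : Type*} [Monoid G] (f : ZMod n → G) (k : ℕ) : G :=
  ((List.range k).map fun k => f ((k : ZMod n) + 1)).reverse.prod

theorem partialProd_succ {G : Type*} [Monoid G] (f : ZMod n → G) (k : ℕ) :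
    partialProd f (k + 1) = f ((k : ZMod n) + 1) * partialProd f k := by
  simp [partialProd, List.range_succ]

/-- Modulo `2π`, the variation of the argument of `⟨-, y⟩` under the reflection is `π`, up to the
variation caused by the normalization of the third coordinate. -/
theorem cartanArg_refl {m y q : V} (hy : IsNegative y) (hym : herm y m = 0) (hq : IsNegative q) :
    ((cartanArg y ((refl m).1 q) - cartanArg y q : ℝ) : Real.Angle) =
      Real.pi - Complex.arg ((refl m).1 q 2) + Complex.arg (q 2) := by
  have hq' : IsNegative ((refl m).1 q) := hq.map _
  have hw : herm q y * y 2 ≠ 0 := mul_ne_zero (herm_ne_zero hq hy) hy.coord_ne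
  have conj_angle : ∀ z : ℂ, ((Complex.arg (conj z) : ℝ) : Real.Angle) = -Complex.arg z :=
    fun z => Complex.arg_conj_coe_angle z
  rw [Real.Angle.coe_sub, cartanArg, cartanArg, herm_refl_left hym, neg_mul, neg_mul, neg_neg, ← neg_mul,
    Complex.arg_mul_coe_angle hw ((map_ne_zero _).2 hq'.coord_ne),
    Complex.arg_mul_coe_angle (neg_ne_zero.2 hw) ((map_ne_zero _).2 hq.coord_ne), conj_angle,
    conj_angle, Complex.arg_neg_coe_angle hw]
  have : (Real.pi : Real.Angle) = -Real.pi := by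
    rw [← Real.Angle.coe_neg, Real.Angle.angle_eq_iff_two_pi_dvd_sub]
    exact ⟨1, by push_cast; ring⟩
  conv_rhs => rw [this]
  abel

theorem continuousAt_cartanArg {y p : V} (hy : IsNegative y) (hp : IsNegative p) :
    ContinuousAt (cartanArg y) p := by
  have h1 : ContinuousAt (fun p : V => -(herm p y * y 2 * conj (p 2))) p := by
    unfold herm
    have : Continuous fun z : ℂ => conj z := Complex.continuous_conj
    fun_prop
  exact ContinuousAt.comp (f := fun p : V => -(herm p y * y 2 * conj (p 2)))
    (Complex.continuousAt_arg (Or.inl (cartan_re_pos hp hy))) h1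

/-- The ball of negative vectors with third coordinate `1` is an affine model of `𝔹`. -/
theorem convex_affineBall : Convex ℝ {p : V | IsNegative p ∧ p 2 = 1} := by
  have : {p : V | IsNegative p ∧ p 2 = 1} =
      {p : V | ‖p 0‖ ^ 2 + ‖p 1‖ ^ 2 < 1} ∩ {p : V | p 2 = 1} := by
    ext p
    simp only [mem_inter_iff, mem_ofPred_eq, isNegative_iff]
    constructor
    · rintro ⟨h, h2⟩; simp_all
    · rintro ⟨h, h2⟩; simp_all
  rw [this]
  refine Convex.inter ?_ ?_
  · have hc : ∀ i : Fin 3, ConvexOn ℝ univ fun p : V => ‖p i‖ ^ 2 := fun i => by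
      have h1 : ConvexOn ℝ univ fun p : V => ‖p i‖ :=
        (convexOn_univ_norm (E := ℂ)).comp_linearMap (LinearMap.proj i : V →ₗ[ℝ] ℂ)
      exact h1.pow (fun _ _ => norm_nonneg _) 2
    have := ((hc 0).add (hc 1)).convex_lt 1
    simpa using this
  · intro p hp q hq s t _ _ hst
    have hp' : p 2 = 1 := hp
    have hq' : q 2 = 1 := hq
    show (s • p + t • q) 2 = 1
    simp [hp', hq']
    exact_mod_cast hst

namespace BisectorCycle

variable (C : BisectorCycle n)

/-- The product `R_k ⋯ R_1` of reflections, as a map of vectors. -/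
def partialMap (k : ℕ) (p : V) : V := (partialProd (fun i => refl (C.m i)) k).1 p

theorem partialMap_zero (p : V) : C.partialMap 0 p = p := rfl

theorem partialMap_succ (k : ℕ) (p : V) :
    C.partialMap (k + 1) p = (refl (C.m ((k : ZMod n) + 1))).1 (C.partialMap k p) := by
  rw [partialMap, partialProd_succ]; rfl

theorem partialMap_self (p : V) : C.partialMap n p = C.δ • p := C.rel p

theorem isNegative_partialMap {p : V} (hp : IsNegative p) (k : ℕ) :
    IsNegative (C.partialMap k p) := hp.map _

theorem continuous_partialMap (k : ℕ) : Continuous (C.partialMap k) :=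
  LinearMap.continuous_of_finiteDimensional (partialProd (fun i => refl (C.m i)) k).1.toLinearMap

theorem delta_ne_zero : C.δ ≠ 0 := by
  intro h
  have hp : IsNegative (![0, 0, 1] : V) := by simp [isNegative_iff]
  have := C.isNegative_partialMap hp n
  rw [partialMap_self, h, zero_smul] at this
  simp [isNegative_iff] at this

/-- The sum over the reflections of the cycle of the variations of the arguments of `⟨-, y i⟩`
between the vertices of the orbit `p, R_1 p, R_2 R_1 p, …`. -/
def totalArg (y : ZMod n → V) (p : V) : ℝ :=
  ∑ k ∈ Finset.range n, (cartanArg (y ((k : ZMod n) + 1)) (C.partialMap (k + 1) p) -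
    cartanArg (y ((k : ZMod n) + 1)) (C.partialMap k p))

/-- Modulo `2π` the sum telescopes, by `R_n ⋯ R_1 = δ`. -/
theorem coe_totalArg {y : ZMod n → V} (hy : ∀ i, IsNegative (y i))
    (hym : ∀ i, herm (y i) (C.m i) = 0) {p : V} (hp : IsNegative p) :
    (C.totalArg y p : Real.Angle) = (n * Real.pi - Complex.arg C.δ : ℝ) := by
  have key : ∀ k : ℕ, ((∑ j ∈ Finset.range k,
      (cartanArg (y ((j : ZMod n) + 1)) (C.partialMap (j + 1) p) -
        cartanArg (y ((j : ZMod n) + 1)) (C.partialMap j p)) : ℝ) : Real.Angle) =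
      (k * Real.pi : ℝ) - Complex.arg (C.partialMap k p 2) + Complex.arg (p 2) := by
    intro k
    induction k with
    | zero => simp [partialMap_zero]
    | succ k ih =>
      rw [Finset.sum_range_succ, Real.Angle.coe_add, ih, partialMap_succ,
        cartanArg_refl (hy _) (hym _) (C.isNegative_partialMap hp k)]
      have : (((k + 1 : ℕ) : ℝ) * Real.pi : ℝ) = k * Real.pi + Real.pi := by push_cast; ring
      rw [this, Real.Angle.coe_add]
      abel
  rw [totalArg, key n, partialMap_self, Pi.smul_apply, smul_eq_mul,
    Complex.arg_mul_coe_angle C.delta_ne_zero hp.coord_ne, Real.Angle.coe_sub]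
  abel

/-- The total variation of the argument does not depend on the point, because it depends on it
continuously and is known modulo `2π`. -/
theorem exists_totalArg_eq {y : ZMod n → V} (hy : ∀ i, IsNegative (y i))
    (hym : ∀ i, herm (y i) (C.m i) = 0) :
    ∃ k : ℤ, ∀ p : V, IsNegative p → p 2 = 1 →
      C.totalArg y p = n * Real.pi - Complex.arg C.δ + 2 * Real.pi * k := by
  set S : Set V := {p : V | IsNegative p ∧ p 2 = 1} with hS
  let f : V → ℝ := fun p =>
    (C.totalArg y p - (n * Real.pi - Complex.arg C.δ)) / (2 * Real.pi)
  have hval : ∀ p, IsNegative p → ∃ k : ℤ,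
      C.totalArg y p - (n * Real.pi - Complex.arg C.δ) = 2 * Real.pi * k := fun p hp =>
    Real.Angle.angle_eq_iff_two_pi_dvd_sub.1 (C.coe_totalArg hy hym hp)
  have hπ : (2 * Real.pi) ≠ 0 := by positivity
  have hcont : ContinuousOn f S := by
    refine ContinuousOn.div_const (ContinuousOn.sub ?_ continuousOn_const) _
    refine continuousOn_finsetSum _ fun k _ => fun p hp => ContinuousAt.continuousWithinAt ?_
    exact ((continuousAt_cartanArg (hy _) (C.isNegative_partialMap hp.1 _)).comp
      (C.continuous_partialMap _).continuousAt).sub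
      ((continuousAt_cartanArg (hy _) (C.isNegative_partialMap hp.1 _)).comp
      (C.continuous_partialMap _).continuousAt)
  have hmaps : MapsTo f S (range ((↑) : ℤ → ℝ)) := fun p hp => by
    obtain ⟨k, hk⟩ := hval p hp.1
    exact ⟨k, by simp only [f, hk]; field_simp⟩
  have hdisc : IsDiscrete (range ((↑) : ℤ → ℝ)) :=
    Int.isClosedEmbedding_coe_real.isInducing.isDiscrete_range
  have he : (![0, 0, 1] : V) ∈ S := ⟨by simp [isNegative_iff], by simp⟩
  obtain ⟨k, hk⟩ := hval _ he.1
  refine ⟨k, fun p hp h2 => ?_⟩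
  have := convex_affineBall.isPreconnected.constant_of_mapsTo hdisc hcont hmaps
    ⟨hp, h2⟩ he
  simp only [f, hk] at this
  rw [div_left_inj' hπ] at this
  linarith

end BisectorCycle

/-! ### Families of lifts permuted by the reflections -/

/-- A family of normalized lifts that is permuted, up to factors, by the generators of `H_n`. Such a
family arises from the translates, by coset representatives, of a map that is equivariant under a
subgroup. -/
structure LiftFamily (C : BisectorCycle n) (P : GeodesicPolygon n) (ι : Type*) where
  lift : ι → ℂ → V
  perm : ZMod n → Equiv.Perm ι
  normalized : ∀ u, IsNormalizedLift (lift u)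
  equivariant : ∀ i u, ∀ x ∈ disc,
    ∃ c : ℂ, lift u (P.turn i x) = c • (refl (C.m i)).1 (lift (perm i u) x)

namespace LiftFamily

variable {C : BisectorCycle n} {P : GeodesicPolygon n} {ι : Type*}
  (Φ : LiftFamily C P ι)

theorem isNegative_lift (u : ι) {x : ℂ} (hx : x ∈ disc) : IsNegative (Φ.lift u x) :=
  (Φ.normalized u).negative x hx

variable [Fintype ι]

theorem sum_vertex_succ {h : V → ℝ} (hh : ∀ (c : ℂ) p, c ≠ 0 → h (c • p) = h p) (i : ZMod n) :
    ∑ u, h (Φ.lift u (P.v (i + 1))) = ∑ u, h ((refl (C.m i)).1 (Φ.lift u (P.v i))) := by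
  rw [← Equiv.sum_comp (Φ.perm i) fun u => h ((refl (C.m i)).1 (Φ.lift u (P.v i)))]
  refine Finset.sum_congr rfl fun u _ => ?_
  obtain ⟨c, hc⟩ := Φ.equivariant i u _ (P.mem_disc i)
  rw [P.turn_v] at hc
  have hc0 : c ≠ 0 := by
    rintro rfl
    have := (Φ.isNegative_lift u (P.mem_disc (i + 1))).coord_ne
    rw [hc, zero_smul] at this
    exact this rfl
  rw [hc, hh c _ hc0]

/-- The images of a vertex under the family are obtained, as a multiset of points of `𝔹`, from
those of the first vertex by the partial products of the reflections. -/
theorem sum_vertex {h : V → ℝ} (hh : ∀ (c : ℂ) p, c ≠ 0 → h (c • p) = h p) (k : ℕ) :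
    ∑ u, h (Φ.lift u (P.v ((k : ZMod n) + 1))) =
      ∑ u, h (C.partialMap k (Φ.lift u (P.v 1))) := by
  induction k generalizing h with
  | zero => simp [BisectorCycle.partialMap_zero]
  | succ k ih =>
    have e : ((k + 1 : ℕ) : ZMod n) + 1 = ((k : ZMod n) + 1) + 1 := by push_cast; rfl
    rw [e, Φ.sum_vertex_succ hh, ih (h := fun p => h ((refl (C.m _)).1 p))]
    · simp only [BisectorCycle.partialMap_succ]
    · intro c p hc
      rw [map_smul, hh c _ hc]

/-- The boundary integrals of the connection forms of the family add up to the total variation of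
the argument, once for each member. -/
theorem sum_edgeIntegral_eq_totalArg {y : ZMod n → V} (hy : ∀ i, IsNegative (y i))
    (hym : ∀ i, herm (y i) (C.m i) = 0) :
    ∑ u, ∑ k ∈ Finset.range n,
      edgeIntegral (liftForm (Φ.lift u)) (P.v k) (P.v ((k : ZMod n) + 1)) =
      ∑ u, C.totalArg y (Φ.lift u (P.v 1)) := by
  let g : ZMod n → ℝ := fun i => ∑ u, (cartanArg (y i) (Φ.lift u (P.v (i + 1))) -
    cartanArg (y i) (Φ.lift u (P.v i)))
  have h1 : ∀ i : ZMod n, ∑ u, edgeIntegral (liftForm (Φ.lift u)) (P.v i) (P.v (i + 1)) = g i :=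
    fun i => IsNormalizedLift.sum_edgeIntegral Φ.normalized (Φ.perm i) (hy i) (hym i)
      (P.mem_disc _) (P.mem_disc _) fun u x hx => Φ.equivariant i u x hx
  have h2 : ∀ k : ℕ, g ((k : ZMod n) + 1) =
      ∑ u, (cartanArg (y ((k : ZMod n) + 1)) (C.partialMap (k + 1) (Φ.lift u (P.v 1))) -
        cartanArg (y ((k : ZMod n) + 1)) (C.partialMap k (Φ.lift u (P.v 1)))) := fun k => by
    have hs : ∀ i (c : ℂ) p, c ≠ 0 → cartanArg (y i) (c • p) = cartanArg (y i) p :=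
      fun i c p hc => cartanArg_smul _ _ hc
    have e := Φ.sum_vertex (hs ((k : ZMod n) + 1)) (k + 1)
    rw [Nat.cast_add_one] at e
    simp only [g, Finset.sum_sub_distrib]
    rw [e, Φ.sum_vertex (hs ((k : ZMod n) + 1)) k]
  have h3 := sum_cyclic_sub g
  rw [Finset.sum_sub_distrib, sub_eq_zero] at h3
  rw [Finset.sum_comm, Finset.sum_congr rfl fun (k : ℕ) _ => h1 k, ← h3,
    Finset.sum_congr rfl fun k _ => h2 k, Finset.sum_comm]
  rfl

theorem exists_sum_edgeIntegral_eq :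
    ∃ k : ℤ, ∑ u, ∑ k ∈ Finset.range n,
      edgeIntegral (liftForm (Φ.lift u)) (P.v k) (P.v ((k : ZMod n) + 1)) =
      Fintype.card ι * (n * Real.pi - Complex.arg C.δ + 2 * Real.pi * k) := by
  choose y hy hym using fun i => exists_isNegative_orthogonal (C.middle i).1
  obtain ⟨k, hk⟩ := C.exists_totalArg_eq hy hym
  refine ⟨k, ?_⟩
  rw [Φ.sum_edgeIntegral_eq_totalArg hy hym, Finset.sum_congr rfl fun u _ =>
    hk _ (Φ.isNegative_lift u (P.mem_disc 1)) ((Φ.normalized u).coord _ (P.mem_disc 1))]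
  simp only [Finset.sum_const, Finset.card_univ, nsmul_eq_mul]

end LiftFamily

/-! ### Maps equivariant under a subgroup -/

/-- The product of reflections that corresponds to a word in the generators. -/
def wordLift (C : BisectorCycle n) (w : List (ZMod n)) : U := (w.map fun i => refl (C.m i)).prod

theorem rep_word (C : BisectorCycle n) (w : List (ZMod n)) :
    (wordLift C w : PU) = C.rep (word w) := by
  induction w with
  | nil => exact (map_one C.rep).symm
  | cons i w ih =>
    have h1 : wordLift C (i :: w) = refl (C.m i) * wordLift C w := by simp [wordLift]
    have h2 : word (i :: w) = r i * word w := by simp [word]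
    have h3 : C.rep (r i) = C.R i := PresentedGroup.toGroup.of _
    rw [h1, h2, map_mul, h3, ← ih]
    rfl

theorem wordLift_append (C : BisectorCycle n) (w w' : List (ZMod n)) :
    wordLift C (w ++ w') = wordLift C w * wordLift C w' := by
  simp [wordLift]

theorem wordLift_reverse (C : BisectorCycle n) (w : List (ZMod n)) :
    wordLift C w.reverse = (wordLift C w)⁻¹ := by
  have h : ∀ i, (refl (C.m i))⁻¹ = refl (C.m i) := fun i =>
    inv_eq_of_mul_eq_one_left (refl_mul_self _)
  simp [wordLift, List.prod_inv_reverse, Function.comp_def, h, List.map_reverse]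

/-- The translates of a `Γ`-equivariant map by representatives of the cosets of `Γ`. The hypothesis
`hperm` says that the generators permute the cosets of the representatives `words u`. -/
def IsEquivariantMap.liftFamily {C : BisectorCycle n} {P : GeodesicPolygon n}
    {Γ : Subgroup (H n)} {F : ℂ → V} (hF : IsEquivariantMap Γ C.rep P F) {ι : Type*}
    (words : ι → List (ZMod n)) (perm : ZMod n → Equiv.Perm ι)
    (hperm : ∀ i u, word (words u ++ [i] ++ (words (perm i u)).reverse) ∈ Γ) :
    LiftFamily C P ι where
  lift u x := ((wordLift C (words u))⁻¹.1 (F (P.act (words u) x)) 2)⁻¹ •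
    (wordLift C (words u))⁻¹.1 (F (P.act (words u) x))
  perm := perm
  normalized u := by
    have hneg : ∀ x ∈ disc, IsNegative ((wordLift C (words u))⁻¹.1 (F (P.act (words u) x))) :=
      fun x hx => (hF.negative _ (P.act_mem _ hx)).map _
    have hs : ContDiffOn ℝ ∞ (fun x => (wordLift C (words u))⁻¹.1 (F (P.act (words u) x))) disc :=
      (LinearMap.toContinuousLinearMap
        ((wordLift C (words u))⁻¹.1.toLinearMap.restrictScalars ℝ)).contDiff.comp_contDiffOn
        (hF.smooth.comp (P.contDiffOn_act _) fun x hx => P.act_mem _ hx)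
    refine ⟨ContDiffOn.smul (ContDiffOn.inv (contDiffOn_pi.1 hs 2) fun x hx =>
      (hneg x hx).coord_ne) hs, fun x hx => (hneg x hx).smul (inv_ne_zero (hneg x hx).coord_ne),
      fun x hx => ?_⟩
    exact inv_mul_cancel₀ (hneg x hx).coord_ne
  equivariant i u x hx := by
    -- With `u'` the new representative, `u r_i u'⁻¹` lies in `Γ`, and it maps `u' x` to `u r_i x`.
    set u' := perm i u
    have hneg : IsNegative ((wordLift C (words u'))⁻¹.1 (F (P.act (words u') x))) :=
      (hF.negative _ (P.act_mem _ hx)).map _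
    obtain ⟨c, hc⟩ := hF.equivariant _ (hperm i u) _ (rep_word C _) _ (P.act_mem (words u') hx)
    rw [P.act_append, P.act_reverse_act _ hx, P.act_append] at hc
    have e : (wordLift C (words u))⁻¹.1 (F (P.act (words u) (P.turn i x))) =
        c • (refl (C.m i)).1 ((wordLift C (words u'))⁻¹.1 (F (P.act (words u') x))) := by
      have h1 : P.act [i] x = P.turn i x := rfl
      rw [← h1, hc, map_smul, wordLift_append, wordLift_append, wordLift_reverse]
      have h2 : wordLift C [i] = refl (C.m i) := by simp [wordLift]
      rw [h2]
      congr 1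
      exact (wordLift C (words u)).1.symm_apply_apply _
    rw [e]
    set q := (wordLift C (words u'))⁻¹.1 (F (P.act (words u') x))
    refine ⟨((c • (refl (C.m i)).1 q) 2)⁻¹ * c * q 2, ?_⟩
    rw [map_smul, smul_smul, smul_smul, mul_assoc _ (q 2), mul_inv_cancel₀ hneg.coord_ne, mul_one]

/-- The value of the Toledo invariant of the restriction to `Γ` modulo `2 |ι|`, where `ι` indexes the
representatives of the cosets of `Γ`. -/
theorem IsEquivariantMap.exists_integral_eq (hn : 2 ≤ n) {C : BisectorCycle n}
    {P : GeodesicPolygon n} {Γ : Subgroup (H n)} {F : ℂ → V} (hF : IsEquivariantMap Γ C.rep P F)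
    {ι : Type*} [Fintype ι] (words : ι → List (ZMod n)) (perm : ZMod n → Equiv.Perm ι)
    (hperm : ∀ i u, word (words u ++ [i] ++ (words (perm i u)).reverse) ∈ Γ) :
    ∃ k : ℤ, 4 / (2 * Real.pi) *
        ∑ u, ∫ x in P.act (words u) '' P.region, pullbackKaehler F x =
      Fintype.card ι * (n - Complex.arg C.δ / Real.pi + 2 * k) := by
  have : NeZero n := ⟨by omega⟩
  let Φ := hF.liftFamily words perm hperm
  obtain ⟨k, hk⟩ := Φ.exists_sum_edgeIntegral_eq
  refine ⟨k, ?_⟩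
  have h1 : ∀ u, 2 * ∫ x in P.act (words u) '' P.region, pullbackKaehler F x =
      ∑ k ∈ Finset.range n,
        edgeIntegral (liftForm (Φ.lift u)) (P.v k) (P.v ((k : ZMod n) + 1)) := fun u => by
    rw [← P.integral_pullbackKaehler hn (Φ.normalized u).smooth (Φ.normalized u).negative,
      P.integral_act_image hF.smooth hF.negative _ P.measurableSet_region P.region_subset_disc]
    congr 1
    refine setIntegral_congr_fun P.measurableSet_region fun x hx => ?_
    have hx' := P.region_subset_disc hx
    have hd : DifferentiableAt ℝ (F ∘ P.act (words u)) x :=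
      ((hF.smooth.comp (P.contDiffOn_act _) fun x hx => P.act_mem _ hx).contDiffAt
        (isOpen_disc.mem_nhds hx')).differentiableAt (by simp)
    have hneg : IsNegative ((wordLift C (words u))⁻¹.1 (F (P.act (words u) x))) :=
      (hF.negative _ (P.act_mem _ hx')).map _
    refine (pullbackKaehler_smul (c := fun x =>
      ((wordLift C (words u))⁻¹.1 (F (P.act (words u) x)) 2)⁻¹) hd
      (hF.negative _ (P.act_mem _ hx')) ?_ (inv_ne_zero hneg.coord_ne) (wordLift C (words u))⁻¹).symm
    have hlin := (LinearMap.toContinuousLinearMap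
        ((wordLift C (words u))⁻¹.1.toLinearMap.restrictScalars ℝ)).differentiableAt.comp x hd
    exact (differentiableAt_pi.1 hlin 2).inv hneg.coord_ne
  have h2 : 2 * ∑ u, ∫ x in P.act (words u) '' P.region, pullbackKaehler F x =
      Fintype.card ι * (n * Real.pi - Complex.arg C.δ + 2 * Real.pi * k) := by
    rw [← hk, Finset.mul_sum, Finset.sum_congr rfl fun u _ => h1 u]
  have hπ := Real.pi_pos.ne'
  have h3 : 4 / (2 * Real.pi) * ∑ u, ∫ x in P.act (words u) '' P.region, pullbackKaehler F x =
      (2 * ∑ u, ∫ x in P.act (words u) '' P.region, pullbackKaehler F x) / Real.pi := by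
    field_simp; ring
  rw [h3, h2]
  field_simp

/-! ### The cosets of the two subgroups -/

theorem r_mul_self (i : ZMod n) : (r i : H n) * r i = 1 := by
  rw [← pow_two]
  exact PresentedGroup.one_of_mem (Or.inr ⟨i, rfl⟩)

theorem r_inv (i : ZMod n) : (r i : H n)⁻¹ = r i := inv_eq_of_mul_eq_one_left (r_mul_self i)

theorem r_one_mul_mem_G (hn : 2 ≤ n) (i : ZMod n) : r 1 * r i ∈ G n := by
  have : NeZero n := ⟨by omega⟩
  have : Fact (1 < n) := ⟨hn⟩
  by_cases h1 : i = 1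
  · rw [h1, r_mul_self]; exact one_mem _
  by_cases h0 : i = 0
  · exact Subgroup.subset_closure ⟨n, hn, le_rfl, by rw [h0, ZMod.natCast_self]⟩
  refine Subgroup.subset_closure ⟨i.val, ?_, (ZMod.val_lt i).le, by rw [ZMod.natCast_zmod_val]⟩
  have h0' : i.val ≠ 0 := by rwa [Ne, ZMod.val_eq_zero]
  have h1' : i.val ≠ 1 := fun h => h1 (by rw [← ZMod.natCast_zmod_val i, h, Nat.cast_one])
  omega

theorem swap_coset_G (hn : 2 ≤ n) (i : ZMod n) (u : Fin 2) :
    word ((![[], [1]] : Fin 2 → List (ZMod n)) u ++ [i] ++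
      ((![[], [1]] : Fin 2 → List (ZMod n)) (Equiv.swap 0 1 u)).reverse) ∈ G n := by
  have h := r_one_mul_mem_G hn i
  have h' := inv_mem h
  rw [mul_inv_rev, r_inv, r_inv] at h'
  fin_cases u
  · simpa [word] using h'
  · simpa [word] using h

/-- The permutation of the four cosets of `T n` by a generator: for odd `n` the quotient of `H n` by
`T n` is the four-group, in which `r 2` and `r 0` have the images `b` and `a b` and the other
generators have the image `a`. -/
def permT (i : ZMod n) : Equiv.Perm (Fin 4) :=
  if i = 0 then ⟨![3, 2, 1, 0], ![3, 2, 1, 0], by decide, by decide⟩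
  else if i = 2 then ⟨![2, 3, 0, 1], ![2, 3, 0, 1], by decide, by decide⟩
  else ⟨![1, 0, 3, 2], ![1, 0, 3, 2], by decide, by decide⟩

/-- Representatives of the four cosets of `T n`. -/
def wordsT (n : ℕ) : Fin 4 → List (ZMod n) := ![[], [1], [2], [2, 1]]

theorem r_mem_T (hn : 3 ≤ n) {i : ZMod n} (h0 : i ≠ 0) (h2 : i ≠ 2) :
    r 1 * r i ∈ T n ∧ r 2 * r 1 * r i * r 2 ∈ T n := by
  have : NeZero n := ⟨by omega⟩
  by_cases h1 : i = 1
  · rw [h1, mul_assoc (r 2), r_mul_self, mul_one, r_mul_self]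
    exact ⟨one_mem _, one_mem _⟩
  have h0' : i.val ≠ 0 := by rwa [Ne, ZMod.val_eq_zero]
  have h1' : i.val ≠ 1 := fun h => h1 (by rw [← ZMod.natCast_zmod_val i, h, Nat.cast_one])
  have h2' : i.val ≠ 2 := fun h => h2 (by rw [← ZMod.natCast_zmod_val i, h, Nat.cast_ofNat])
  have hlt := ZMod.val_lt i
  have hi : ((i.val : ℕ) : ZMod n) = i := ZMod.natCast_zmod_val i
  exact ⟨Subgroup.subset_closure (Or.inr ⟨i.val, by omega, by omega, Or.inl (by rw [hi])⟩),
    Subgroup.subset_closure (Or.inr ⟨i.val, by omega, by omega, Or.inr (by rw [hi])⟩)⟩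

theorem perm_coset_T (hn : 3 ≤ n) (i : ZMod n) (u : Fin 4) :
    word (wordsT n u ++ [i] ++ (wordsT n (permT i u)).reverse) ∈ T n := by
  have inv : ∀ {g : H n}, g ∈ T n → g⁻¹ ∈ T n := fun h => inv_mem h
  have hz : r 2 * r 1 * r 2 * r 1 ∈ T n := Subgroup.subset_closure (Or.inl (by simp))
  have hx : r 2 * r 1 * r 0 ∈ T n := Subgroup.subset_closure (Or.inl (by simp))
  have hy : r 2 * r 0 * r 1 ∈ T n := Subgroup.subset_closure (Or.inl (by simp))
  by_cases h0 : i = 0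
  · have hx' := inv hx
    have hy' := inv hy
    simp only [mul_inv_rev, r_inv] at hx' hy'
    subst h0
    fin_cases u
    · simpa [word, wordsT, permT, mul_assoc] using hx'
    · simpa [word, wordsT, permT, mul_assoc] using hy'
    · simpa [word, wordsT, permT, mul_assoc] using hy
    · simpa [word, wordsT, permT, mul_assoc] using hx
  by_cases h2 : i = 2
  · have hz' := inv hz
    simp only [mul_inv_rev, r_inv] at hz'
    subst h2
    fin_cases u
    · simp [word, wordsT, permT, h0, r_mul_self]
    · simpa [word, wordsT, permT, h0, mul_assoc] using hz'
    · simp [word, wordsT, permT, h0, r_mul_self]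
    · simpa [word, wordsT, permT, h0, mul_assoc] using hz
  obtain ⟨h1, h3⟩ := r_mem_T hn h0 h2
  have h1' := inv h1
  have h3' := inv h3
  simp only [mul_inv_rev, r_inv] at h1' h3'
  fin_cases u
  · simpa [word, wordsT, permT, h0, h2, mul_assoc] using h1'
  · simpa [word, wordsT, permT, h0, h2, mul_assoc] using h1
  · simpa [word, wordsT, permT, h0, h2, mul_assoc] using h3'
  · simpa [word, wordsT, permT, h0, h2, mul_assoc] using h3

end CxHyp

end

theorem proposition2p1p15 (n : ℕ) (hn : 5 ≤ n) (C : CxHyp.BisectorCycle n) :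
    (∀ τ : ℝ, CxHyp.IsToledoInvariant ⊤ (CxHyp.regionH n) C.rep τ →
      ∃ k : ℤ, τ = n - Complex.arg C.δ / Real.pi + 2 * k) ∧
    (Even n → ∀ τ : ℝ, CxHyp.IsToledoInvariant (CxHyp.G n) (CxHyp.regionG n) C.rep τ →
      ∃ k : ℤ, τ = -(2 * Complex.arg C.δ / Real.pi) + 4 * k) ∧
    (Odd n → ∀ τ : ℝ, CxHyp.IsToledoInvariant (CxHyp.T n) (CxHyp.regionT n) C.rep τ →
      ∃ k : ℤ, τ = 4 * n - 4 * Complex.arg C.δ / Real.pi + 8 * k) := by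
  refine ⟨?_, ?_, ?_⟩
  · rintro τ ⟨P, F, hF, rfl⟩
    obtain ⟨k, hk⟩ := hF.exists_integral_eq (by omega) (fun _ : Fin 1 => []) (fun _ => 1)
      fun _ _ => Subgroup.mem_top _
    refine ⟨k, ?_⟩
    simpa [CxHyp.regionH] using hk
  · rintro ⟨m, rfl⟩ τ ⟨P, F, hF, rfl⟩
    obtain ⟨k, hk⟩ := hF.exists_integral_eq (by omega) (![[], [1]] : Fin 2 → _)
      (fun _ => Equiv.swap 0 1) (CxHyp.swap_coset_G (by omega))
    -- For `n = 2 m` the term `2 n = 4 m` is absorbed by the modulus.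
    refine ⟨m + k, ?_⟩
    rw [Fin.sum_univ_two] at hk
    refine Eq.trans ?_ (hk.trans ?_)
    · simp [CxHyp.regionG]
    · push_cast [Fintype.card_fin]; ring
  · rintro - τ ⟨P, F, hF, rfl⟩
    obtain ⟨k, hk⟩ := hF.exists_integral_eq (by omega) (CxHyp.wordsT n) CxHyp.permT
      (CxHyp.perm_coset_T (by omega))
    refine ⟨k, ?_⟩
    rw [Fin.sum_univ_four] at hk
    refine Eq.trans ?_ (hk.trans ?_)
    · simp [CxHyp.regionT, CxHyp.wordsT, add_assoc]
    · push_cast [Fintype.card_fin]; ring
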